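/- There is an absolute constant $C>0$ with the following property. Let $m_x>0$, $L_x\ge m_x$, $L_{xy},L_y\ge 0$, $D_x\ge 0$, $D_y>0$, put $L=\max\{L_x,L_{xy},L_y\}$, and let $0<\epsilon\le\max\{L_{xy},m_x\}\,D_y^2$. A first-order method with projections is a finite sequence of instructions, fixed in advance, each of which forms a linear combination of two stored vectors with fixed real coefficients, projects a stored vector onto $\mathcal X$ or $\mathcal Y$, or evaluates $(\nabla_x f,\nabla_y f)$ at a stored point; its gradient complexity is the number of gradient evaluations. There is such a method, depending only on $m_x,L_x,L_{xy},L_y,D_x,D_y,\epsilon$ (not on the dimensions, the domains, the function or the initial point), that makes at most $$C\,\sqrt{\frac{L_x}{m_x}+\Bigl(\frac{L\,L_{xy}}{m_x}+L_y\Bigr)\frac{D_y^2}{\epsilon}}\;\ln^4\!\Bigl(2+\frac{(D_x+D_y)^2L^2}{m_x\epsilon}\Bigr)$$ gradient evaluations, and, if moreover $\epsilon L_x\le (m_xL_y+L\,L_{xy})D_y^2$ (which follows from the above when $L_x=L_y$), at most $$C\,D_y\sqrt{\frac{m_xL_y+L\,L_{xy}}{m_x\,\epsilon}}\;\ln^4\!\Bigl(2+\frac{(D_x+D_y)^2L^2}{m_x\epsilon}\Bigr)=\tilde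 O\Bigl(\sqrt{\tfrac{m_xL_y+L\,L_{xy}}{m_x\epsilon}}\Bigr),$$ such that the following holds for all $n,m$, all nonempty compact convex sets $\mathcal X\subset\mathbb R^n$, $\mathcal Y\subset\mathbb R^m$ of diameters at most $D_x$ and $D_y$, every initial point $(x_0,y_0)\in\mathcal X\times\mathcal Y$, and every $f:\mathbb R^n\times\mathbb R^m\to\mathbb R$ that on $\mathcal X\times\mathcal Y$ is differentiable, $m_x$-strongly convex in $x$, concave in $y$, and $(L_x,L_{xy},L_y)$-smooth (that is, $\nabla_x f$ is $L_x$-Lipschitz in $x$ and $L_{xy}$-Lipschitz in $y$, and $\nabla_y f$ is $L_y$-Lipschitz in $y$ and $L_{xy}$-Lipschitz in $x$). Started at $(x_0,y_0)$, the method outputs $(\hat x,\hat y)\in\mathcal X\times\mathcal Y$ that is an $(\epsilon/2)$-saddle point of the regularized function $f(x,y)-\frac{\epsilon}{2D_y^2}\|y-y_0\|^2$ and an $\epsilon$-saddle point of $f$, i.e. $$\max_{y\in\mathcal Y}f(\hat x,y)-\min_{x\in\mathcal X}f(x,\hat y)\le\epsilon .$$ -/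

import Mathlib

noncomputable section

namespace Minimax

section Problem

variable {E F : Type*} [NormedAddCommGroup E] [InnerProductSpace ℝ E] [CompleteSpace E]
  [NormedAddCommGroup F] [InnerProductSpace ℝ F] [CompleteSpace F]

/-- The partial gradient `∇ₓ f (x, y)`. -/
def gradX (f : E → F → ℝ) (x : E) (y : F) : E := gradient (fun u => f u y) x

/-- The partial gradient `∇_y f (x, y)`. -/
def gradY (f : E → F → ℝ) (x : E) (y : F) : F := gradient (fun v => f x v) y

/-- `f` is `(Lx, Lxy, Ly)`-smooth on `X × Y`: it is (jointly) differentiable at every point of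
`X × Y`, the partial gradient in either variable is Lipschitz in that variable with constant
`Lx`, resp. `Ly`, and Lipschitz in the other variable with constant `Lxy`. -/
structure IsSmoothOn (X : Set E) (Y : Set F) (f : E → F → ℝ) (Lx Lxy Ly : ℝ) : Prop where
  differentiable : ∀ x ∈ X, ∀ y ∈ Y, DifferentiableAt ℝ (fun z : E × F => f z.1 z.2) (x, y)
  lip_xx : ∀ y ∈ Y, ∀ x ∈ X, ∀ x' ∈ X, ‖gradX f x y - gradX f x' y‖ ≤ Lx * ‖x - x'‖
  lip_yy : ∀ x ∈ X, ∀ y ∈ Y, ∀ y' ∈ Y, ‖gradY f x y - gradY f x y'‖ ≤ Ly * ‖y - y'‖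
  lip_xy : ∀ x ∈ X, ∀ y ∈ Y, ∀ y' ∈ Y, ‖gradX f x y - gradX f x y'‖ ≤ Lxy * ‖y - y'‖
  lip_yx : ∀ y ∈ Y, ∀ x ∈ X, ∀ x' ∈ X, ‖gradY f x y - gradY f x' y‖ ≤ Lxy * ‖x - x'‖

/-- The strongly convex-concave class on `X × Y`: `f` is `(Lx, Lxy, Ly)`-smooth, `mx`-strongly
convex in `x` and concave in `y`. -/
structure IsSCC (X : Set E) (Y : Set F) (f : E → F → ℝ) (mx Lx Lxy Ly : ℝ) : Prop where
  smooth : IsSmoothOn X Y f Lx Lxy Ly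
  strongConvex : ∀ y ∈ Y, StrongConvexOn X mx (fun x => f x y)
  concave : ∀ x ∈ X, ConcaveOn ℝ Y (fun y => f x y)

/-- `(x, y)` is an `ε`-saddle point of `f : X × Y → ℝ`:
`max_{v ∈ Y} f (x, v) - min_{u ∈ X} f (u, y) ≤ ε`, the maximum and the minimum being attained. -/
def IsEpsSaddle (X : Set E) (Y : Set F) (f : E → F → ℝ) (ε : ℝ) (x : E) (y : F) : Prop :=
  x ∈ X ∧ y ∈ Y ∧ ∃ M m : ℝ,
    IsGreatest ((fun v => f x v) '' Y) M ∧ IsLeast ((fun u => f u y) '' X) m ∧ M - m ≤ ε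

/-- The function `f (x, y) - ε ‖y - y₀‖² / (2 D²)`. -/
def regularized (f : E → F → ℝ) (ε D : ℝ) (y₀ : F) (x : E) (y : F) : ℝ :=
  f x y - ε * ‖y - y₀‖ ^ 2 / (2 * D ^ 2)

/-- The projection onto `S`: a point of `S` nearest to `u` (it exists and is unique when `S` is
nonempty, closed and convex in a Euclidean space). -/
def proj (S : Set E) (u : E) : E :=
  open Classical in
  if h : ∃ v ∈ S, ∀ w ∈ S, ‖u - v‖ ≤ ‖u - w‖ then h.choose else u

end Problem

/-! ### First-order methods with projections

A method works with vector registers `0, 1, 2, …` in the space of `x` and in the space of `y`.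
Its instructions form linear combinations of two registers with fixed real coefficients, project
a register onto the feasible set, or evaluate the gradient of `f` at the point given by an
`x`-register and a `y`-register. The function is accessed through gradient evaluations only. -/

/-- The instructions of a first-order method with projections. -/
inductive Instr : Type
  /-- `x_dst := s • x_a + t • x_b` -/
  | combX (dst : ℕ) (s : ℝ) (a : ℕ) (t : ℝ) (b : ℕ)
  /-- `y_dst := s • y_a + t • y_b` -/
  | combY (dst : ℕ) (s : ℝ) (a : ℕ) (t : ℝ) (b : ℕ)
  /-- `x_dst := P_X [x_a]` -/
  | projX (dst a : ℕ)
  /-- `y_dst := P_Y [y_a]` -/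
  | projY (dst a : ℕ)
  /-- `(x_dx, y_dy) := ∇ f (x_a, y_b)` -/
  | grad (dx dy a b : ℕ)

/-- A first-order method: a finite list of instructions, executed in order. -/
abbrev Method := List Instr

/-- The number of gradient evaluations of an instruction. -/
def Instr.cost : Instr → ℕ
  | .grad _ _ _ _ => 1
  | _ => 0

/-- The number of gradient evaluations that a method makes. -/
def Method.gradCount (P : Method) : ℕ := (P.map Instr.cost).sum

section Semantics

variable {E F : Type*} [NormedAddCommGroup E] [InnerProductSpace ℝ E] [CompleteSpace E]
  [NormedAddCommGroup F] [InnerProductSpace ℝ F] [CompleteSpace F]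

/-- The effect of one instruction on the contents of the registers. -/
def Instr.exec (X : Set E) (Y : Set F) (f : E → F → ℝ) :
    Instr → (ℕ → E) × (ℕ → F) → (ℕ → E) × (ℕ → F)
  | .combX dst s a t b, σ => (Function.update σ.1 dst (s • σ.1 a + t • σ.1 b), σ.2)
  | .combY dst s a t b, σ => (σ.1, Function.update σ.2 dst (s • σ.2 a + t • σ.2 b))
  | .projX dst a, σ => (Function.update σ.1 dst (proj X (σ.1 a)), σ.2)
  | .projY dst a, σ => (σ.1, Function.update σ.2 dst (proj Y (σ.2 a)))
  | .grad dx dy a b, σ =>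
    (Function.update σ.1 dx (gradX f (σ.1 a) (σ.2 b)),
      Function.update σ.2 dy (gradY f (σ.1 a) (σ.2 b)))

/-- The contents of the registers after running `P` from the state `σ`. -/
def Method.run (X : Set E) (Y : Set F) (f : E → F → ℝ) (P : Method)
    (σ : (ℕ → E) × (ℕ → F)) : (ℕ → E) × (ℕ → F) :=
  P.foldl (fun τ i => i.exec X Y f τ) σ

/-- The `x`-part of the output: all registers start at the initial point `(x₀, y₀)`, and
the output is read off register `0`. -/
def Method.outX (X : Set E) (Y : Set F) (f : E → F → ℝ) (P : Method) (x₀ : E) (y₀ : F) : E :=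
  (Method.run X Y f P (fun _ => x₀, fun _ => y₀)).1 0

/-- The `y`-part of the output. -/
def Method.outY (X : Set E) (Y : Set F) (f : E → F → ℝ) (P : Method) (x₀ : E) (y₀ : F) : F :=
  (Method.run X Y f P (fun _ => x₀, fun _ => y₀)).2 0

end Semantics

/-- `L = max {Lx, Lxy, Ly}`. -/
def maxL (Lx Lxy Ly : ℝ) : ℝ := max Lx (max Lxy Ly)

/-- The logarithmic factor `ln⁴ (2 + (Dx + Dy)² L² / (mx ε))`. -/
def logFactor (mx L Dx Dy ε : ℝ) : ℝ :=
  Real.log (2 + (Dx + Dy) ^ 2 * L ^ 2 / (mx * ε)) ^ 4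

end Minimax

end

/-! Regularization by `ε / (2 * Dy ^ 2) * ‖y - y₀‖ ^ 2` changes the gap by at most `ε / 2`, because
`Y` has diameter at most `Dy`, and makes the problem strongly concave in `y` with modulus `b = ε /
Dy ^ 2`. It remains to approximate the saddle point of a strongly convex-strongly concave problem
with about `√(Lx / mx + (L * Lxy / mx + Ly) / b)` gradients, up to logarithms.

The engine is one accelerated method (`accelerated_step`, `exists_accelerated`) for any map with the
inequality `ProxStep`. Two kinds of maps have it: a projected gradient step (`proxStep_projGrad`),
and the proximal step of a marginal function such as `x ↦ max_y h x y`, which is read off from the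
saddle point of a more regular problem (`prox_saddle_le`). The map may be computed inexactly. The
potential is evaluated at the exact image of the map, never at the computed point, so neither a
Lipschitz constant nor a gradient of the marginal function is needed.

The loops are nested. An accelerated proximal method in `x` with weight `σ = 2 * Lxy + mx` calls one
in `y` with weight `τ = 2 * Lxy + b`. In the innermost problem both moduli are at least `2 * Lxy`,
so the best responses are `1 / 2`-Lipschitz and alternating them contracts (`solve_alternating`);
each best response is found by accelerated gradient steps. The counts multiply to `√(σ / mx) * √(τ /
b)` times the square root of a best-response condition number, `(Lx + σ) / (mx + σ)` or `(Ly + b +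
τ) / (b + τ)`. The denominator cancels against `σ` or `τ`, which gives the claimed root
(`complexity_left`, `complexity_right`). Four nested loops give four logarithms.

All accuracies have the form `D / R ^ j`, where `D = Dx + Dy` and `R` is the argument of the
logarithm. Since `R` dominates `L / mx` and `L / b`, polynomial losses cost only finitely many
powers of `R`. Nearness to the saddle point does not by itself bound the gap, as gradients may be
large there; a last projected gradient step in each variable does this (`Inst.gap_le`).

That a single method serves all problems is built into `Der`: a computed vector is a family indexed
by all problem instances, and one program must produce the entire family. -/

open scoped InnerProductSpace

namespace Minimax

/-! ### Projections, strong convexity, proximal steps and the accelerated step. -/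

section ConvexAnalysis

variable {E : Type*} [NormedAddCommGroup E] [InnerProductSpace ℝ E]

theorem proj_spec [CompleteSpace E] {X : Set E} (hne : X.Nonempty) (hc : IsComplete X) (hX : Convex ℝ X)
    (u : E) : proj X u ∈ X ∧ ∀ w ∈ X, ⟪u - proj X u, w - proj X u⟫_ℝ ≤ 0 := by
  have hex : ∃ v ∈ X, ∀ w ∈ X, ‖u - v‖ ≤ ‖u - w‖ := by
    obtain ⟨v, hv, h⟩ := exists_norm_eq_iInf_of_complete_convex hne hc hX u
    refine ⟨v, hv, fun w hw => ?_⟩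
    rw [h]
    exact ciInf_le ⟨0, by rintro _ ⟨_, rfl⟩; exact norm_nonneg _⟩ (⟨w, hw⟩ : X)
  have hp : proj X u = hex.choose := by simp only [proj, dif_pos hex]
  have hmem : proj X u ∈ X := hp ▸ hex.choose_spec.1
  have hmin : ∀ w ∈ X, ‖u - proj X u‖ ≤ ‖u - w‖ := hp ▸ hex.choose_spec.2
  refine ⟨hmem, (norm_eq_iInf_iff_real_inner_le_zero hX hmem).1 ?_⟩
  have : Nonempty X := ⟨⟨_, hmem⟩⟩
  exact le_antisymm (le_ciInf fun w => hmin w w.2)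
    (ciInf_le ⟨0, by rintro _ ⟨_, rfl⟩; exact norm_nonneg _⟩ (⟨_, hmem⟩ : X))

/-- A minimizer of a strongly convex function enjoys quadratic growth. -/
theorem growth_of_isMinOn {X : Set E} {φ : E → ℝ} {μ : ℝ} (hφ : StrongConvexOn X μ φ)
    {x : E} (hx : x ∈ X) (hmin : ∀ u ∈ X, φ x ≤ φ u) {u : E} (hu : u ∈ X) :
    φ x + μ / 2 * ‖u - x‖ ^ 2 ≤ φ u := by
  by_contra! hlt
  -- Compare with the point at parameter `t` on the segment from `x` to `u` and divide by `t`; a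
  -- small explicit `t` then replaces the limit `t → 0`.
  have key : ∀ t : ℝ, 0 < t → t < 1 → φ x + (1 - t) * (μ / 2 * ‖u - x‖ ^ 2) ≤ φ u := by
    intro t ht ht1
    have h1 := hφ.2 hu hx ht.le (sub_nonneg.2 ht1.le) (by ring)
    have h2 := hmin _ (hφ.1 hu hx ht.le (sub_nonneg.2 ht1.le) (by ring))
    simp only [smul_eq_mul] at h1
    have h3 : t * (φ x + (1 - t) * (μ / 2 * ‖u - x‖ ^ 2)) ≤ t * φ u := by nlinarith
    exact le_of_mul_le_mul_left h3 ht
  set c := μ / 2 * ‖u - x‖ ^ 2 with hc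
  have h0 := hmin u hu
  have hcpos : 0 < c := by linarith
  have := key ((φ x + c - φ u) / (2 * c)) (by apply div_pos <;> linarith)
    (by rw [div_lt_one (by linarith)]; linarith)
  have e : (1 - (φ x + c - φ u) / (2 * c)) * c = c - (φ x + c - φ u) / 2 := by
    field_simp
  rw [e] at this
  linarith

/-- First-order lower bound for a strongly convex function. -/
theorem gradient_le_of_strongConvexOn [CompleteSpace E] {X : Set E} {φ : E → ℝ} {μ : ℝ}
    (hφ : StrongConvexOn X μ φ) {x g u : E} (hx : x ∈ X) (hg : HasGradientAt φ g x) (hu : u ∈ X) :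
    φ x + ⟪g, u - x⟫_ℝ + μ / 2 * ‖u - x‖ ^ 2 ≤ φ u := by
  have hd : HasDerivAt (fun t : ℝ => φ (x + t • (u - x))) ⟪g, u - x⟫_ℝ 0 := by
    have h1 : HasDerivAt (fun t : ℝ => x + t • (u - x)) (u - x) 0 := by
      simpa using ((hasDerivAt_id (0 : ℝ)).smul_const (u - x)).const_add x
    have h2 : HasFDerivAt φ (InnerProductSpace.toDual ℝ E g) (x + (0 : ℝ) • (u - x)) := by
      simpa using hg.hasFDerivAt
    have h3 := h2.comp_hasDerivAt (0 : ℝ) h1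
    simp only [InnerProductSpace.toDual_apply_apply] at h3
    exact h3
  have hs := hd.tendsto_slope_zero_right
  have hlim : Filter.Tendsto (fun t : ℝ => φ u - φ x - (1 - t) * (μ / 2 * ‖u - x‖ ^ 2))
      (nhdsWithin 0 (Set.Ioi 0)) (nhds (φ u - φ x - (1 - 0) * (μ / 2 * ‖u - x‖ ^ 2))) := by
    apply Filter.Tendsto.mono_left _ nhdsWithin_le_nhds
    exact Continuous.tendsto (by fun_prop) 0
  have hle := le_of_tendsto_of_tendsto hs hlim (by
    filter_upwards [Ioo_mem_nhdsGT (zero_lt_one : (0 : ℝ) < 1)] with t ht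
    have h1 := hφ.2 hu hx ht.1.le (sub_nonneg.2 ht.2.le) (by ring)
    have e : t • u + (1 - t) • x = x + t • (u - x) := by module
    rw [e] at h1
    simp only [smul_eq_mul, zero_add, zero_smul, add_zero] at h1 ⊢
    have : t⁻¹ * (φ (x + t • (u - x)) - φ x) ≤
        t⁻¹ * (t * (φ u - φ x - (1 - t) * (μ / 2 * ‖u - x‖ ^ 2))) :=
      mul_le_mul_of_nonneg_left (by nlinarith) (inv_nonneg.2 ht.1.le)
    rwa [inv_mul_cancel_left₀ ht.1.ne'] at this)
  linarith

/-- The descent lemma on a convex set. -/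
theorem descent_le [CompleteSpace E] {X : Set E} (hX : Convex ℝ X) {φ : E → ℝ} {G : E → E} {L : ℝ}
    (hg : ∀ x ∈ X, HasGradientAt φ (G x) x)
    (hL : ∀ x ∈ X, ∀ x' ∈ X, ‖G x - G x'‖ ≤ L * ‖x - x'‖) {x u : E} (hx : x ∈ X) (hu : u ∈ X) :
    φ u ≤ φ x + ⟪G x, u - x⟫_ℝ + L / 2 * ‖u - x‖ ^ 2 := by
  have hmem : ∀ t ∈ Set.Icc (0 : ℝ) 1, x + t • (u - x) ∈ X := fun t ht => by
    have e : x + t • (u - x) = (1 - t) • x + t • u := by module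
    rw [e]
    exact hX hx hu (sub_nonneg.2 ht.2) ht.1 (by ring)
  have hd : ∀ t ∈ Set.Icc (0 : ℝ) 1, HasDerivAt (fun t : ℝ => φ (x + t • (u - x)))
      ⟪G (x + t • (u - x)), u - x⟫_ℝ t := fun t ht => by
    have h1 : HasDerivAt (fun t : ℝ => x + t • (u - x)) (u - x) t := by
      simpa using ((hasDerivAt_id t).smul_const (u - x)).const_add x
    have h3 := (hg _ (hmem t ht)).hasFDerivAt.comp_hasDerivAt t h1
    simp only [InnerProductSpace.toDual_apply_apply] at h3
    exact h3
  have hB : ∀ t : ℝ, HasDerivAt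
      (fun t : ℝ => φ x + t * ⟪G x, u - x⟫_ℝ + L / 2 * ‖u - x‖ ^ 2 * t ^ 2)
      (⟪G x, u - x⟫_ℝ + L * ‖u - x‖ ^ 2 * t) t := fun t => by
    have := (((hasDerivAt_id t).mul_const ⟪G x, u - x⟫_ℝ).const_add (φ x)).add
      ((hasDerivAt_pow 2 t).const_mul (L / 2 * ‖u - x‖ ^ 2))
    refine this.congr_deriv ?_
    simp only [Nat.cast_ofNat]; ring
  have := image_le_of_deriv_right_le_deriv_boundary
    (f := fun t : ℝ => φ (x + t • (u - x))) (a := 0) (b := 1)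
    (f' := fun t => ⟪G (x + t • (u - x)), u - x⟫_ℝ)
    (fun t ht => (hd t ht).continuousAt.continuousWithinAt)
    (fun t ht => (hd t ⟨ht.1, ht.2.le⟩).hasDerivWithinAt)
    (B := fun t : ℝ => φ x + t * ⟪G x, u - x⟫_ℝ + L / 2 * ‖u - x‖ ^ 2 * t ^ 2)
    (B' := fun t => ⟪G x, u - x⟫_ℝ + L * ‖u - x‖ ^ 2 * t)
    (by simp) (fun t _ => (hB t).continuousAt.continuousWithinAt)
    (fun t _ => (hB t).hasDerivWithinAt)
    (fun t ht => by
      have h1 := hL _ (hmem t ⟨ht.1, ht.2.le⟩) x hx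
      have h2 := real_inner_le_norm (G (x + t • (u - x)) - G x) (u - x)
      rw [inner_sub_left] at h2
      have h3 : ‖x + t • (u - x) - x‖ = t * ‖u - x‖ := by
        rw [add_sub_cancel_left, norm_smul, Real.norm_of_nonneg ht.1]
      rw [h3] at h1
      have h4 := mul_le_mul_of_nonneg_right h1 (norm_nonneg (u - x))
      nlinarith)
    (Set.right_mem_Icc.2 zero_le_one)
  simpa using this

/-- `p` behaves like a proximal (or projected gradient) step for `φ` on `X`. -/
def ProxStep (X : Set E) (φ : E → ℝ) (p : E → E) (β μ : ℝ) : Prop :=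
  ∀ x, p x ∈ X ∧ ∀ u ∈ X, φ (p x) + β / 2 * ‖u - p x‖ ^ 2 ≤ φ u + (β - μ) / 2 * ‖u - x‖ ^ 2

theorem proxStep_projGrad [CompleteSpace E] {X : Set E} (hne : X.Nonempty) (hc : IsComplete X)
    (hX : Convex ℝ X) {φ : E → ℝ} {G : E → E} {L μ : ℝ} (hLpos : 0 < L) (hμ : 0 ≤ μ) (hμL : μ ≤ L)
    (hφ : StrongConvexOn X μ φ)
    (hg : ∀ x ∈ X, HasGradientAt φ (G x) x)
    (hL : ∀ x ∈ X, ∀ x' ∈ X, ‖G x - G x'‖ ≤ L * ‖x - x'‖) :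
    ProxStep X φ (fun x => proj X (x - L⁻¹ • G (proj X x))) L (μ / 2) := by
  intro x
  set w := proj X x with hw
  obtain ⟨hwX, hwi⟩ := proj_spec hne hc hX x
  obtain ⟨hpX, hpi⟩ := proj_spec hne hc hX (x - L⁻¹ • G w)
  set p := proj X (x - L⁻¹ • G w) with hp
  refine ⟨hpX, fun u hu => ?_⟩
  have h1 := gradient_le_of_strongConvexOn hφ hwX (hg w hwX) hu
  have h2 := descent_le hX hg hL hwX hpX
  have h3 := hpi u hu
  have h4 := hwi p hpX
  rw [← hw] at h4
  have h3' : L * ⟪x - p, u - p⟫_ℝ ≤ ⟪G w, u - p⟫_ℝ := by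
    have e : x - L⁻¹ • G w - p = (x - p) - L⁻¹ • G w := by abel
    rw [e, inner_sub_left, real_inner_smul_left] at h3
    have := mul_le_mul_of_nonneg_left h3 hLpos.le
    rw [mul_sub, mul_inv_cancel_left₀ hLpos.ne'] at this
    linarith
  have e1 : ⟪G w, u - w⟫_ℝ = ⟪G w, u - p⟫_ℝ + ⟪G w, p - w⟫_ℝ := by
    rw [← inner_add_right]; congr 1; abel
  have e2 : ‖u - x‖ ^ 2 = ‖u - p‖ ^ 2 - 2 * ⟪x - p, u - p⟫_ℝ + ‖x - p‖ ^ 2 := by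
    have : u - x = (u - p) - (x - p) := by abel
    rw [this, norm_sub_sq_real, real_inner_comm]
  have e3 : ‖x - p‖ ^ 2 = ‖x - w‖ ^ 2 - 2 * ⟪x - w, p - w⟫_ℝ + ‖p - w‖ ^ 2 := by
    have : x - p = (x - w) - (p - w) := by abel
    rw [this, norm_sub_sq_real]
  have e4 : ‖u - x‖ ^ 2 ≤ 2 * ‖u - w‖ ^ 2 + 2 * ‖x - w‖ ^ 2 := by
    have : u - x = (u - w) - (x - w) := by abel
    rw [this]
    nlinarith [parallelogram_law_with_norm ℝ (u - w) (x - w), sq_nonneg ‖(u - w) + (x - w)‖]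
  have hA : L / 2 * (‖x - w‖ ^ 2 + ‖p - w‖ ^ 2) ≤ L / 2 * ‖x - p‖ ^ 2 :=
    mul_le_mul_of_nonneg_left (by linarith) (by linarith)
  have hB : μ / 4 * ‖u - x‖ ^ 2 ≤ μ / 4 * (2 * ‖u - w‖ ^ 2 + 2 * ‖x - w‖ ^ 2) :=
    mul_le_mul_of_nonneg_left e4 (by linarith)
  have hC : μ / 2 * ‖x - w‖ ^ 2 ≤ L / 2 * ‖x - w‖ ^ 2 :=
    mul_le_mul_of_nonneg_right (by linarith) (sq_nonneg _)
  have hD : L / 2 * ‖u - x‖ ^ 2 =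
      L / 2 * ‖u - p‖ ^ 2 - L * ⟪x - p, u - p⟫_ℝ + L / 2 * ‖x - p‖ ^ 2 := by rw [e2]; ring
  change φ p + L / 2 * ‖u - p‖ ^ 2 ≤ φ u + (L - μ / 2) / 2 * ‖u - x‖ ^ 2
  linarith

/-- The proximal step of `x ↦ max_y h (x, y)`, given by a saddle point of the regularized
function, is a `ProxStep`. -/
theorem prox_saddle_le {F : Type*} {X : Set E} {Y : Set F} {h : E → F → ℝ} {μ β : ℝ} (hμ : 0 ≤ μ)
    (hμβ : μ ≤ β) {x xp : E} {yp : F} (hxp : xp ∈ X) (hyp : yp ∈ Y)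
    (hmax : ∀ v ∈ Y, h xp v ≤ h xp yp)
    (hmin : ∀ u ∈ X, h xp yp + β / 2 * ‖xp - x‖ ^ 2 + (μ + β) / 2 * ‖u - xp‖ ^ 2 ≤
      h u yp + β / 2 * ‖u - x‖ ^ 2)
    {Yb : E → F} (hYb : ∀ x ∈ X, Yb x ∈ Y ∧ ∀ v ∈ Y, h x v ≤ h x (Yb x)) {u : E} (hu : u ∈ X) :
    h xp (Yb xp) + β / 2 * ‖u - xp‖ ^ 2 ≤ h u (Yb u) + (β - μ / 2) / 2 * ‖u - x‖ ^ 2 := by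
  have h1 := hmax _ (hYb xp hxp).1
  have h2 := (hYb u hu).2 yp hyp
  have h3 := hmin u hu
  have e4 : ‖u - x‖ ^ 2 ≤ 2 * ‖u - xp‖ ^ 2 + 2 * ‖xp - x‖ ^ 2 := by
    have : u - x = (u - xp) + (xp - x) := by abel
    rw [this]
    nlinarith [parallelogram_law_with_norm ℝ (u - xp) (xp - x), sq_nonneg ‖(u - xp) - (xp - x)‖]
  have hB : μ / 4 * ‖u - x‖ ^ 2 ≤ μ / 4 * (2 * ‖u - xp‖ ^ 2 + 2 * ‖xp - x‖ ^ 2) :=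
    mul_le_mul_of_nonneg_left e4 (by linarith)
  have hC : μ / 2 * ‖xp - x‖ ^ 2 ≤ β / 2 * ‖xp - x‖ ^ 2 :=
    mul_le_mul_of_nonneg_right (by linarith) (sq_nonneg _)
  linarith

theorem norm_sq_convexComb (α : ℝ) (Z Y : E) : ‖(1 - α) • Z + α • Y‖ ^ 2 =
    (1 - α) * ‖Z‖ ^ 2 + α * ‖Y‖ ^ 2 - α * (1 - α) * ‖Z - Y‖ ^ 2 := by
  rw [norm_add_sq_real, norm_sub_sq_real, norm_smul, norm_smul, real_inner_smul_left,
    real_inner_smul_right, mul_pow, mul_pow, Real.norm_eq_abs, Real.norm_eq_abs, sq_abs, sq_abs]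
  ring

set_option maxHeartbeats 800000 in
/-- One step of the accelerated method with an inexact `ProxStep`. -/
theorem accelerated_step {X : Set E} {φ : E → ℝ} {p : E → E} {β μ α δ : ℝ}
    (hp : ProxStep X φ p β μ) (hα : 0 < α) (hα2 : α ≤ 1 / 2) (hβ : 0 < β)
    (hαβ : 4 * α ^ 2 * β = μ) {xs : E} (hxs : xs ∈ X) (hmin : ∀ u ∈ X, φ xs ≤ φ u)
    {a x z : E} (ha : a ∈ X) (hxa : ‖x - a‖ ≤ δ) {y x' z' : E}
    (hy : (1 + α) • y = x + α • z) (hx' : ‖x' - p y‖ ≤ δ)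
    (hz' : z' = (1 - α) • z + α • y - (1 / (4 * α)) • (y - x')) :
    φ (p y) - φ xs + μ / 2 * ‖z' - xs‖ ^ 2 ≤
      (1 - α / 2) * (φ a - φ xs + μ / 2 * ‖z - xs‖ ^ 2) + β / α * δ ^ 2 := by
  obtain ⟨hpX, hpu⟩ := hp y
  have h1 := hpu a ha
  have h2 := hpu xs hxs
  set q := p y with hq
  set e := x - a with he
  set e' := x' - q with he'
  set g := y - q with hg
  set Y := y - xs with hY
  set Z := z - xs with hZ
  have hμ : 0 < μ := by rw [← hαβ]; positivity
  set W := (1 - α) • Z + α • Y with hW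
  -- The displacement from `xs` that an exact oracle would give. The step `1 / (4 * α)` equals `α *
  -- β / μ`, the usual one for the gradient mapping `β • g`.
  set zb := W - (1 / (4 * α)) • g with hzb
  have hA : a - y = α • (Y - Z) - e := by
    have : x = (1 + α) • y - α • z := by rw [hy]; abel
    simp only [hY, hZ, he, this]
    module
  have ez : z' - xs = zb + (1 / (4 * α)) • e' := by
    rw [hz', hzb, hW, hg, he', hY, hZ]
    module
  have E1 : ‖a - q‖ ^ 2 = ‖a - y‖ ^ 2 + 2 * (α * ⟪Y, g⟫_ℝ - α * ⟪Z, g⟫_ℝ - ⟪e, g⟫_ℝ) + ‖g‖ ^ 2 := by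
    have : a - q = (a - y) + g := by rw [hg]; abel
    rw [this, norm_add_sq_real, hA, inner_sub_left, real_inner_smul_left, inner_sub_left]
    ring
  have E2 : ‖xs - q‖ ^ 2 = ‖Y‖ ^ 2 - 2 * ⟪Y, g⟫_ℝ + ‖g‖ ^ 2 := by
    have : xs - q = g - Y := by rw [hg, hY]; abel
    rw [this, norm_sub_sq_real, real_inner_comm]; ring
  have E3 : ‖xs - y‖ ^ 2 = ‖Y‖ ^ 2 := by rw [norm_sub_rev]
  have E4 : μ / 2 * ‖zb‖ ^ 2 = μ / 2 * ‖W‖ ^ 2 - α * β * ⟪W, g⟫_ℝ + β / 8 * ‖g‖ ^ 2 := by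
    rw [hzb, norm_sub_sq_real, norm_smul, real_inner_smul_right,
      Real.norm_of_nonneg (by positivity), ← hαβ]
    field_simp
    ring
  have E5 : ⟪W, g⟫_ℝ = (1 - α) * ⟪Z, g⟫_ℝ + α * ⟪Y, g⟫_ℝ := by
    rw [hW, inner_add_left, real_inner_smul_left, real_inner_smul_left]
  have E6 : ‖W‖ ^ 2 ≤ (1 - α) * ‖Z‖ ^ 2 + α * ‖Y‖ ^ 2 := by
    have h0 := norm_sq_convexComb α Z Y
    rw [← hW] at h0
    have : 0 ≤ α * (1 - α) * ‖Z - Y‖ ^ 2 :=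
      mul_nonneg (mul_nonneg hα.le (by linarith)) (sq_nonneg _)
    linarith
  -- The coefficient `3 / 8` is the slack `1 / 2 - 1 / 8` left in front of `β * ‖g‖ ^ 2`. It exists
  -- because `α` is half of the classical `√(μ / β)`; the classical choice would use up the whole
  -- term.
  have E7 : ⟪e, g⟫_ℝ ≤ 3 / 8 * ‖g‖ ^ 2 + δ ^ 2 := by
    have h3 := real_inner_le_norm e g
    have h4 : ‖e‖ * ‖g‖ ≤ δ * ‖g‖ := mul_le_mul_of_nonneg_right hxa (norm_nonneg _)
    nlinarith [sq_nonneg (δ - 1 / 2 * ‖g‖), sq_nonneg ‖g‖]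
  have E7' : (1 - α) * ⟪e, g⟫_ℝ ≤ 3 / 8 * ‖g‖ ^ 2 + δ ^ 2 := by
    have : (1 - α) * ⟪e, g⟫_ℝ ≤ (1 - α) * (3 / 8 * ‖g‖ ^ 2 + δ ^ 2) :=
      mul_le_mul_of_nonneg_left E7 (by linarith)
    nlinarith [mul_nonneg hα.le (show 0 ≤ 3 / 8 * ‖g‖ ^ 2 + δ ^ 2 by positivity)]
  rw [E1] at h1
  rw [E2, E3] at h2
  clear_value zb W Z Y g e e'
  have hbar : φ q - φ xs + μ / 2 * ‖zb‖ ^ 2 ≤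
      (1 - α) * (φ a - φ xs + μ / 2 * ‖Z‖ ^ 2) + β * δ ^ 2 := by
    have k1 := mul_le_mul_of_nonneg_left h1 (show (0 : ℝ) ≤ 1 - α by linarith)
    have k2 := mul_le_mul_of_nonneg_left h2 hα.le
    have k3 := mul_le_mul_of_nonneg_left E6 (show (0 : ℝ) ≤ μ / 2 by linarith)
    have k4 := mul_le_mul_of_nonneg_left E7' hβ.le
    have k5 : 0 ≤ (1 - α) * (μ / 2 * ‖a - y‖ ^ 2) :=
      mul_nonneg (by linarith) (by positivity)
    rw [E4, E5]
    linarith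
  have hV : 0 ≤ φ a - φ xs + μ / 2 * ‖Z‖ ^ 2 := by
    have := hmin a ha
    have : 0 ≤ μ / 2 * ‖Z‖ ^ 2 := by positivity
    linarith
  have hq0 := hmin q hpX
  -- The oracle error in `z'` is split off by Young's inequality with factor `1 + α / 2`, which is
  -- affordable since `(1 + α / 2) * (1 - α) ≤ 1 - α / 2`.
  have E8 : ‖z' - xs‖ ^ 2 ≤ (1 + α / 2) * ‖zb‖ ^ 2 + (1 + 2 / α) * (δ ^ 2 / (16 * α ^ 2)) := by
    set s := (1 / (4 * α)) • e' with hs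
    have hs1 : ‖s‖ ^ 2 ≤ δ ^ 2 / (16 * α ^ 2) := by
      rw [hs, norm_smul, Real.norm_of_nonneg (by positivity), mul_pow]
      have : ‖e'‖ ^ 2 ≤ δ ^ 2 := pow_le_pow_left₀ (norm_nonneg _) hx' 2
      calc (1 / (4 * α)) ^ 2 * ‖e'‖ ^ 2 ≤ (1 / (4 * α)) ^ 2 * δ ^ 2 :=
            mul_le_mul_of_nonneg_left this (by positivity)
        _ = _ := by field_simp; ring
    have h5 : ‖z' - xs‖ ≤ ‖zb‖ + ‖s‖ := by rw [ez]; exact norm_add_le _ _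
    have h6 : ‖z' - xs‖ ^ 2 ≤ (‖zb‖ + ‖s‖) ^ 2 := pow_le_pow_left₀ (norm_nonneg _) h5 2
    have h7 : 2 * (‖zb‖ * ‖s‖) ≤ α / 2 * ‖zb‖ ^ 2 + 2 / α * ‖s‖ ^ 2 := by
      have : 0 ≤ (α * ‖zb‖ - 2 * ‖s‖) ^ 2 / (2 * α) := by positivity
      have e9 : (α * ‖zb‖ - 2 * ‖s‖) ^ 2 / (2 * α) =
          α / 2 * ‖zb‖ ^ 2 + 2 / α * ‖s‖ ^ 2 - 2 * (‖zb‖ * ‖s‖) := by field_simp; ring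
      linarith
    have h8 : (1 + 2 / α) * ‖s‖ ^ 2 ≤ (1 + 2 / α) * (δ ^ 2 / (16 * α ^ 2)) :=
      mul_le_mul_of_nonneg_left hs1 (by positivity)
    linarith
  have E9 : μ / 2 * ((1 + 2 / α) * (δ ^ 2 / (16 * α ^ 2))) = β * δ ^ 2 / 8 * (1 + 2 / α) := by
    rw [← hαβ]; field_simp; ring
  have k6 := mul_le_mul_of_nonneg_left E8 (show (0 : ℝ) ≤ μ / 2 by linarith)
  have k7 := mul_le_mul_of_nonneg_left hbar (show (0 : ℝ) ≤ 1 + α / 2 by linarith)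
  have k8 : (1 + α / 2) * (β * δ ^ 2) + β * δ ^ 2 / 8 * (1 + 2 / α) ≤ β / α * δ ^ 2 := by
    have hb : 0 ≤ β * δ ^ 2 := by positivity
    have hi : 2 ≤ 1 / α := by rw [le_div_iff₀ hα]; linarith
    have e10 : β / α * δ ^ 2 = β * δ ^ 2 * (1 / α) := by ring
    have e11 : (2 : ℝ) / α = 2 * (1 / α) := by ring
    have e12 : (1 + α / 2) + (1 + 2 * (1 / α)) / 8 ≤ 1 / α := by linarith
    have e13 := mul_le_mul_of_nonneg_left e12 hb
    rw [e10, e11]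
    linarith
  have k9 : (1 + α / 2) * ((1 - α) * (φ a - φ xs + μ / 2 * ‖Z‖ ^ 2)) ≤
      (1 - α / 2) * (φ a - φ xs + μ / 2 * ‖Z‖ ^ 2) := by
    rw [← mul_assoc]
    exact mul_le_mul_of_nonneg_right (by nlinarith) hV
  have k10 : 0 ≤ α / 2 * (φ q - φ xs) := mul_nonneg (by linarith) (by linarith)
  linarith

end ConvexAnalysis

/-! ### Quadratic perturbations, saddle points and Lipschitz best responses. -/

section Saddle

variable {E F : Type*} [NormedAddCommGroup E] [InnerProductSpace ℝ E] [CompleteSpace E]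
  [NormedAddCommGroup F] [InnerProductSpace ℝ F] [CompleteSpace F]

noncomputable section

set_option linter.unusedSectionVars false

/-- `f` perturbed by quadratic functions of `x` and of `y`. -/
def pert (f : E → F → ℝ) (a : ℝ) (p : E) (b : ℝ) (q : F) (x : E) (y : F) : ℝ :=
  f x y + (a / 2 * ‖x‖ ^ 2 - ⟪p, x⟫_ℝ) - (b / 2 * ‖y‖ ^ 2 - ⟪q, y⟫_ℝ)

/-- Minimizer over `X` with quadratic growth of modulus `μ`. -/
def IsStrongMin (X : Set E) (φ : E → ℝ) (μ : ℝ) (x : E) : Prop :=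
  x ∈ X ∧ ∀ u ∈ X, φ x + μ / 2 * ‖u - x‖ ^ 2 ≤ φ u

theorem IsStrongMin.le {X : Set E} {φ : E → ℝ} {μ : ℝ} {x : E} (h : IsStrongMin X φ μ x)
    (hμ : 0 ≤ μ) {u : E} (hu : u ∈ X) : φ x ≤ φ u := by
  have := h.2 u hu
  have : 0 ≤ μ / 2 * ‖u - x‖ ^ 2 := by positivity
  linarith

theorem exists_isStrongMin {X : Set E} (hX : IsCompact X) (hne : X.Nonempty) {φ : E → ℝ} {μ : ℝ}
    (hc : ContinuousOn φ X) (hφ : StrongConvexOn X μ φ) : ∃ x, IsStrongMin X φ μ x := by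
  obtain ⟨x, hx, hmin⟩ := hX.exists_isMinOn hne hc
  exact ⟨x, hx, fun u hu => growth_of_isMinOn hφ hx (fun v hv => hmin hv) hu⟩

theorem strongConvexOn_add_quad {X : Set E} {φ : E → ℝ} {m : ℝ} (hφ : StrongConvexOn X m φ)
    (a : ℝ) (p : E) (c : ℝ) :
    StrongConvexOn X (m + a) (fun x => φ x + (a / 2 * ‖x‖ ^ 2 - ⟪p, x⟫_ℝ) + c) := by
  rw [strongConvexOn_iff_convex] at hφ ⊢
  refine ⟨hφ.1, fun x hx y hy s t hs ht hst => ?_⟩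
  have := hφ.2 hx hy hs ht hst
  simp only [smul_eq_mul, inner_add_right, real_inner_smul_right] at this ⊢
  have ec : c = s * c + t * c := by rw [← add_mul, hst, one_mul]
  linarith

theorem hasGradientAt_quad (a : ℝ) (p : E) (c : ℝ) (x : E) :
    HasGradientAt (fun x : E => a / 2 * ‖x‖ ^ 2 - ⟪p, x⟫_ℝ + c) (a • x - p) x := by
  rw [hasGradientAt_iff_hasFDerivAt]
  have h1 : HasFDerivAt (fun x : E => ‖x‖ ^ 2) (2 • innerSL ℝ x) x :=
    (hasStrictFDerivAt_norm_sq x).hasFDerivAt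
  have h2 : HasFDerivAt (fun x : E => ⟪p, x⟫_ℝ) (innerSL ℝ p) x := (innerSL ℝ p).hasFDerivAt
  refine (((h1.const_mul (a / 2)).sub h2).add_const c).congr_fderiv ?_
  ext u
  simp
  ring

theorem HasGradientAt.add' {φ ψ : E → ℝ} {g g' x : E} (h : HasGradientAt φ g x)
    (h' : HasGradientAt ψ g' x) : HasGradientAt (fun x => φ x + ψ x) (g + g') x := by
  rw [hasGradientAt_iff_hasFDerivAt] at *
  rw [map_add]
  exact h.add h'

theorem HasGradientAt.neg' {φ : E → ℝ} {g x : E} (h : HasGradientAt φ g x) :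
    HasGradientAt (fun x => -φ x) (-g) x := by
  rw [hasGradientAt_iff_hasFDerivAt] at *
  rw [map_neg]
  exact h.neg

variable {X : Set E} {Y : Set F} {f : E → F → ℝ} {mx Lx Lxy Ly : ℝ}

theorem IsSmoothOn.hasGradientAt_left (hf : IsSmoothOn X Y f Lx Lxy Ly) {x : E} {y : F}
    (hx : x ∈ X) (hy : y ∈ Y) : HasGradientAt (fun u => f u y) (gradX f x y) x :=
  ((hf.differentiable x hx y hy).comp x (f := fun u => (u, y))
    (by fun_prop)).hasGradientAt

theorem IsSmoothOn.hasGradientAt_right (hf : IsSmoothOn X Y f Lx Lxy Ly) {x : E} {y : F}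
    (hx : x ∈ X) (hy : y ∈ Y) : HasGradientAt (fun v => f x v) (gradY f x y) y :=
  ((hf.differentiable x hx y hy).comp y (f := fun v => (x, v))
    (by fun_prop)).hasGradientAt

variable (a : ℝ) (p : E) (b : ℝ) (q : F)

theorem IsSmoothOn.hasGradientAt_pert_left (hf : IsSmoothOn X Y f Lx Lxy Ly) {x : E} {y : F}
    (hx : x ∈ X) (hy : y ∈ Y) :
    HasGradientAt (fun u => pert f a p b q u y) (gradX f x y + (a • x - p)) x := by
  have := HasGradientAt.add' (hf.hasGradientAt_left hx hy)
    (hasGradientAt_quad a p (-(b / 2 * ‖y‖ ^ 2 - ⟪q, y⟫_ℝ)) x)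
  refine this.congr_of_eventuallyEq (Filter.Eventually.of_forall fun u => ?_)
  simp only [pert]; ring

theorem IsSmoothOn.hasGradientAt_pert_right (hf : IsSmoothOn X Y f Lx Lxy Ly) {x : E} {y : F}
    (hx : x ∈ X) (hy : y ∈ Y) :
    HasGradientAt (fun v => -pert f a p b q x v) (-gradY f x y + (b • y - q)) y := by
  have := HasGradientAt.add' (HasGradientAt.neg' (hf.hasGradientAt_right hx hy))
    (hasGradientAt_quad b q (-(a / 2 * ‖x‖ ^ 2 - ⟪p, x⟫_ℝ)) y)
  refine this.congr_of_eventuallyEq (Filter.Eventually.of_forall fun u => ?_)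
  simp only [pert]; ring

theorem IsSmoothOn.lip_pert_left (hf : IsSmoothOn X Y f Lx Lxy Ly) (ha : 0 ≤ a) {y : F}
    (hy : y ∈ Y) : ∀ x ∈ X, ∀ x' ∈ X,
    ‖(gradX f x y + (a • x - p)) - (gradX f x' y + (a • x' - p))‖ ≤ (Lx + a) * ‖x - x'‖ := by
  intro x hx x' hx'
  have e : (gradX f x y + (a • x - p)) - (gradX f x' y + (a • x' - p)) =
      (gradX f x y - gradX f x' y) + a • (x - x') := by module
  rw [e]
  refine (norm_add_le _ _).trans ?_
  rw [norm_smul, Real.norm_of_nonneg ha, add_mul]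
  exact add_le_add_left (hf.lip_xx y hy x hx x' hx') _

theorem IsSmoothOn.lip_pert_right (hf : IsSmoothOn X Y f Lx Lxy Ly) (hb : 0 ≤ b) {x : E}
    (hx : x ∈ X) : ∀ y ∈ Y, ∀ y' ∈ Y,
    ‖(-gradY f x y + (b • y - q)) - (-gradY f x y' + (b • y' - q))‖ ≤ (Ly + b) * ‖y - y'‖ := by
  intro y hy y' hy'
  have e : (-gradY f x y + (b • y - q)) - (-gradY f x y' + (b • y' - q)) =
      -(gradY f x y - gradY f x y') + b • (y - y') := by module
  rw [e]
  refine (norm_add_le _ _).trans ?_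
  rw [norm_smul, norm_neg, Real.norm_of_nonneg hb, add_mul]
  exact add_le_add_left (hf.lip_yy x hx y hy y' hy') _

theorem IsSCC.strongConvexOn_pert_left (hf : IsSCC X Y f mx Lx Lxy Ly) {y : F} (hy : y ∈ Y) :
    StrongConvexOn X (mx + a) (fun u => pert f a p b q u y) := by
  have := strongConvexOn_add_quad (hf.strongConvex y hy) a p (-(b / 2 * ‖y‖ ^ 2 - ⟪q, y⟫_ℝ))
  convert this using 2
  simp only [pert]; ring

theorem IsSCC.strongConvexOn_pert_right (hf : IsSCC X Y f mx Lx Lxy Ly) {x : E} (hx : x ∈ X) :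
    StrongConvexOn Y b (fun v => -pert f a p b q x v) := by
  have h0 : StrongConvexOn Y 0 (fun v => -f x v) := by
    rw [strongConvexOn_zero]; exact (hf.concave x hx).neg
  have := strongConvexOn_add_quad h0 b q (-(a / 2 * ‖x‖ ^ 2 - ⟪p, x⟫_ℝ))
  rw [zero_add] at this
  convert this using 2
  simp only [pert]; ring

theorem IsSmoothOn.continuousOn_pert_left (hf : IsSmoothOn X Y f Lx Lxy Ly) {y : F} (hy : y ∈ Y) :
    ContinuousOn (fun u => pert f a p b q u y) X := fun _ hx =>
  (hf.hasGradientAt_pert_left a p b q hx hy).differentiableAt.continuousAt.continuousWithinAt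

theorem IsSmoothOn.continuousOn_pert_right (hf : IsSmoothOn X Y f Lx Lxy Ly) {x : E}
    (hx : x ∈ X) : ContinuousOn (fun v => -pert f a p b q x v) Y := fun _ hy =>
  (hf.hasGradientAt_pert_right a p b q hx hy).differentiableAt.continuousAt.continuousWithinAt

theorem IsSCC.exists_best_left (hf : IsSCC X Y f mx Lx Lxy Ly) (hX : IsCompact X)
    (hne : X.Nonempty) {y : F} (hy : y ∈ Y) :
    ∃ x, IsStrongMin X (fun u => pert f a p b q u y) (mx + a) x :=
  exists_isStrongMin hX hne (hf.smooth.continuousOn_pert_left a p b q hy)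
    (hf.strongConvexOn_pert_left a p b q hy)

theorem IsSCC.exists_best_right (hf : IsSCC X Y f mx Lx Lxy Ly) (hY : IsCompact Y)
    (hne : Y.Nonempty) {x : E} (hx : x ∈ X) :
    ∃ y, IsStrongMin Y (fun v => -pert f a p b q x v) b y :=
  exists_isStrongMin hY hne (hf.smooth.continuousOn_pert_right a p b q hx)
    (hf.strongConvexOn_pert_right a p b q hx)

/-- `(x, y)` is a saddle point with quadratic growth of moduli `μ`, `ν`. -/
def IsStrongSaddle (X : Set E) (Y : Set F) (h : E → F → ℝ) (μ ν : ℝ) (x : E) (y : F) : Prop :=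
  IsStrongMin X (fun u => h u y) μ x ∧ IsStrongMin Y (fun v => -h x v) ν y

/-- Sion's theorem supplies the saddle point; strong convexity in each variable separately supplies
the growth. -/
theorem IsSCC.exists_isStrongSaddle (hf : IsSCC X Y f mx Lx Lxy Ly) (hX : IsCompact X)
    (hXc : Convex ℝ X) (hXne : X.Nonempty) (hY : IsCompact Y) (hYc : Convex ℝ Y)
    (hYne : Y.Nonempty) (ha : 0 ≤ mx + a) (hb : 0 ≤ b) :
    ∃ x y, IsStrongSaddle X Y (pert f a p b q) (mx + a) b x y := by
  obtain ⟨x, hx, y, hy, hs⟩ := Sion.exists_isSaddlePointOn (f := pert f a p b q) hXne hXc hX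
    (fun y hy => (hf.smooth.continuousOn_pert_left a p b q hy).lowerSemicontinuousOn)
    (fun y hy => ((hf.strongConvexOn_pert_left a p b q hy).convexOn
      (fun r => by simp only [Pi.zero_apply]; positivity)).quasiconvexOn) hYc hYne hY
    (fun x hx => by
      have := (hf.smooth.continuousOn_pert_right a p b q hx).neg
      simp only [Pi.neg_def, neg_neg] at this
      exact this.upperSemicontinuousOn)
    (fun x hx => by
      have := ((hf.strongConvexOn_pert_right a p b q hx).convexOn
        (fun r => by simp only [Pi.zero_apply]; positivity)).neg
      simp only [Pi.neg_def, neg_neg] at this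
      exact this.quasiconcaveOn)
  refine ⟨x, y, ⟨hx, fun u hu => growth_of_isMinOn (hf.strongConvexOn_pert_left a p b q hy) hx
    (fun w hw => hs w hw y hy) hu⟩, hy, fun v hv =>
    growth_of_isMinOn (hf.strongConvexOn_pert_right a p b q hx) hy
      (fun w hw => neg_le_neg (hs x hx w hw)) hv⟩

/-- Mean value inequality for `u ↦ f u y - f u y'`, whose gradient has norm at most `Lxy * ‖y -
y'‖`. The perturbation separates the variables and cancels in the mixed difference. -/
theorem IsSmoothOn.cross_le (hf : IsSmoothOn X Y f Lx Lxy Ly) (hXc : Convex ℝ X)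
    {x x' : E} {y y' : F} (hx : x ∈ X) (hx' : x' ∈ X) (hy : y ∈ Y) (hy' : y' ∈ Y) :
    pert f a p b q x' y - pert f a p b q x' y' - (pert f a p b q x y - pert f a p b q x y') ≤
      Lxy * ‖y - y'‖ * ‖x' - x‖ := by
  have hd : ∀ u ∈ X, HasFDerivWithinAt (fun u => f u y - f u y')
      (InnerProductSpace.toDual ℝ E (gradX f u y - gradX f u y')) X u := fun u hu => by
    rw [map_sub]
    exact ((hf.hasGradientAt_left hu hy).hasFDerivAt.sub
      (hf.hasGradientAt_left hu hy').hasFDerivAt).hasFDerivWithinAt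
  have := hXc.norm_image_sub_le_of_norm_hasFDerivWithin_le hd
    (C := Lxy * ‖y - y'‖) (fun u hu => by
      rw [LinearIsometryEquiv.norm_map]; exact hf.lip_xy u hu y hy y' hy') hx hx'
  have := (Real.le_norm_self _).trans this
  simp only [pert]
  linarith

/-- The two growth inequalities add up to `(mx + a) * ‖x - x'‖ ^ 2` below a mixed difference, to
which `cross_le` applies. The same argument serves the other variable. -/
theorem IsSCC.best_left_lipschitz (hf : IsSCC X Y f mx Lx Lxy Ly) (hXc : Convex ℝ X)
    (hμ : 0 < mx + a) (hL : 0 ≤ Lxy) {y y' : F} (hy : y ∈ Y) (hy' : y' ∈ Y) {x x' : E}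
    (hx : IsStrongMin X (fun u => pert f a p b q u y) (mx + a) x)
    (hx' : IsStrongMin X (fun u => pert f a p b q u y') (mx + a) x') :
    ‖x - x'‖ ≤ Lxy / (mx + a) * ‖y - y'‖ := by
  have h1 := hx.2 x' hx'.1
  have h2 := hx'.2 x hx.1
  have h3 := hf.smooth.cross_le a p b q hXc hx.1 hx'.1 hy hy'
  simp only at h1 h2
  rw [norm_sub_rev x' x] at h1 h3
  rcases (norm_nonneg (x - x')).eq_or_lt with h0 | h0
  · rw [← h0]; positivity
  · rw [div_mul_eq_mul_div, le_div_iff₀ hμ]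
    have h7 : ‖x - x'‖ * (mx + a) * ‖x - x'‖ ≤ Lxy * ‖y - y'‖ * ‖x - x'‖ := by linarith
    exact le_of_mul_le_mul_right h7 h0

theorem IsSCC.best_right_lipschitz (hf : IsSCC X Y f mx Lx Lxy Ly) (hXc : Convex ℝ X)
    (hb : 0 < b) (hL : 0 ≤ Lxy) {x x' : E} (hx : x ∈ X) (hx' : x' ∈ X) {y y' : F}
    (hy : IsStrongMin Y (fun v => -pert f a p b q x v) b y)
    (hy' : IsStrongMin Y (fun v => -pert f a p b q x' v) b y') :
    ‖y - y'‖ ≤ Lxy / b * ‖x - x'‖ := by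
  have h1 := hy.2 y' hy'.1
  have h2 := hy'.2 y hy.1
  have h3 := hf.smooth.cross_le a p b q hXc hx' hx hy.1 hy'.1
  simp only at h1 h2
  rw [norm_sub_rev y' y] at h1
  rcases (norm_nonneg (y - y')).eq_or_lt with h0 | h0
  · rw [← h0]; positivity
  · rw [div_mul_eq_mul_div, le_div_iff₀ hb]
    have h7 : ‖y - y'‖ * b * ‖y - y'‖ ≤ Lxy * ‖x - x'‖ * ‖y - y'‖ := by linarith
    exact le_of_mul_le_mul_right h7 h0

end

end Saddle

/-! ### Straight-line programs acting on all problem instances at once. -/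

/-- A problem of the class considered, with its initial point. -/
structure Inst (mx Lx Lxy Ly Dx Dy : ℝ) where
  n : ℕ
  m : ℕ
  X : Set (EuclideanSpace ℝ (Fin n))
  Y : Set (EuclideanSpace ℝ (Fin m))
  f : EuclideanSpace ℝ (Fin n) → EuclideanSpace ℝ (Fin m) → ℝ
  x₀ : EuclideanSpace ℝ (Fin n)
  y₀ : EuclideanSpace ℝ (Fin m)
  compactX : IsCompact X
  convexX : Convex ℝ X
  compactY : IsCompact Y
  convexY : Convex ℝ Y
  memX : x₀ ∈ X
  memY : y₀ ∈ Y
  diamX : Metric.diam X ≤ Dx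
  diamY : Metric.diam Y ≤ Dy
  scc : IsSCC X Y f mx Lx Lxy Ly

noncomputable section Programs

variable {mx Lx Lxy Ly Dx Dy : ℝ}

/-- The space of `x`. -/
abbrev Inst.E (I : Inst mx Lx Lxy Ly Dx Dy) : Type := EuclideanSpace ℝ (Fin I.n)

/-- The space of `y`. -/
abbrev Inst.F (I : Inst mx Lx Lxy Ly Dx Dy) : Type := EuclideanSpace ℝ (Fin I.m)

variable (mx Lx Lxy Ly Dx Dy) in
/-- The vectors that have been computed: families of vectors indexed by the problems. -/
abbrev Known : Type :=
  Set (∀ I : Inst mx Lx Lxy Ly Dx Dy, I.E) × Set (∀ I : Inst mx Lx Lxy Ly Dx Dy, I.F)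

/-- The registers after running a program on a problem. -/
def Inst.run (I : Inst mx Lx Lxy Ly Dx Dy) (P : Method) : (ℕ → I.E) × (ℕ → I.F) :=
  Method.run I.X I.Y I.f P (fun _ => I.x₀, fun _ => I.y₀)

theorem Inst.run_append (I : Inst mx Lx Lxy Ly Dx Dy) (P : Method) (i : Instr) :
    I.run (P ++ [i]) = i.exec I.X I.Y I.f (I.run P) := by
  simp [Inst.run, Method.run, List.foldl_append]

theorem gradCount_append (P : Method) (i : Instr) :
    Method.gradCount (P ++ [i]) = Method.gradCount P + i.cost := by
  simp [Method.gradCount]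

/-- After running `P`, the registers below `N` hold all vectors of `S`. -/
def Holds (P : Method) (N : ℕ) (S : Known mx Lx Lxy Ly Dx Dy) : Prop :=
  (∀ u ∈ S.1, ∃ r < N, ∀ I, (I.run P).1 r = u I) ∧ ∀ v ∈ S.2, ∃ r < N, ∀ I, (I.run P).2 r = v I

/-- The vectors of `S'` can be computed from those of `S` with `c` gradient evaluations. -/
def Der (c : ℕ) (S S' : Known mx Lx Lxy Ly Dx Dy) : Prop :=
  S.1 ⊆ S'.1 ∧ S.2 ⊆ S'.2 ∧ ∀ P N, Holds P N S →
    ∃ P' N', Method.gradCount P' ≤ Method.gradCount P + c ∧ Holds P' N' S'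

theorem Der.refl (S : Known mx Lx Lxy Ly Dx Dy) : Der 0 S S :=
  ⟨subset_rfl, subset_rfl, fun P N h => ⟨P, N, le_rfl, h⟩⟩

theorem Der.trans {c c' : ℕ} {S S' S'' : Known mx Lx Lxy Ly Dx Dy} (h : Der c S S')
    (h' : Der c' S' S'') : Der (c + c') S S'' := by
  refine ⟨h.1.trans h'.1, h.2.1.trans h'.2.1, fun P N hP => ?_⟩
  obtain ⟨P', N', h1, h2⟩ := h.2.2 P N hP
  obtain ⟨P'', N'', h3, h4⟩ := h'.2.2 P' N' h2
  exact ⟨P'', N'', by omega, h4⟩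

/-- A single instruction that leaves the registers below `N` alone. -/
theorem Der.of_instr {S S' : Known mx Lx Lxy Ly Dx Dy} (hS : S.1 ⊆ S'.1) (hS' : S.2 ⊆ S'.2) {c : ℕ}
    (h : ∀ P N, Holds P N S → ∃ i : Instr, i.cost ≤ c ∧
      (∀ I : Inst mx Lx Lxy Ly Dx Dy, ∀ r < N, (I.run (P ++ [i])).1 r = (I.run P).1 r) ∧
      (∀ I : Inst mx Lx Lxy Ly Dx Dy, ∀ r < N, (I.run (P ++ [i])).2 r = (I.run P).2 r) ∧
      (∀ u ∈ S'.1, u ∈ S.1 ∨ ∀ I : Inst mx Lx Lxy Ly Dx Dy, (I.run (P ++ [i])).1 N = u I) ∧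
      (∀ v ∈ S'.2, v ∈ S.2 ∨ ∀ I : Inst mx Lx Lxy Ly Dx Dy, (I.run (P ++ [i])).2 N = v I)) :
    Der c S S' := by
  refine ⟨hS, hS', fun P N hP => ?_⟩
  obtain ⟨i, hc, h1, h2, h3, h4⟩ := h P N hP
  -- The result goes to the fresh register `N`, so nothing known is overwritten.
  refine ⟨P ++ [i], N + 1, by rw [gradCount_append]; omega, fun u hu => ?_, fun v hv => ?_⟩
  · rcases h3 u hu with hu | hu
    · obtain ⟨r, hr, e⟩ := hP.1 u hu
      exact ⟨r, by omega, fun I => by rw [h1 I r hr, e I]⟩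
    · exact ⟨N, by omega, hu⟩
  · rcases h4 v hv with hv | hv
    · obtain ⟨r, hr, e⟩ := hP.2 v hv
      exact ⟨r, by omega, fun I => by rw [h2 I r hr, e I]⟩
    · exact ⟨N, by omega, hv⟩

theorem Der.combX {S : Known mx Lx Lxy Ly Dx Dy} {u v : ∀ I : Inst mx Lx Lxy Ly Dx Dy, I.E}
    (hu : u ∈ S.1) (hv : v ∈ S.1) (s t : ℝ) :
    Der 0 S (insert (fun I => s • u I + t • v I) S.1, S.2) := by
  refine Der.of_instr (Set.subset_insert _ _) (by exact subset_rfl) fun P N hP => ?_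
  obtain ⟨a, ha, ea⟩ := hP.1 u hu
  obtain ⟨b, hb, eb⟩ := hP.1 v hv
  refine ⟨.combX N s a t b, le_rfl, fun I r hr => ?_, fun I r hr => ?_, fun w hw => ?_,
    fun w hw => Or.inl hw⟩
  · rw [I.run_append]; simp [Instr.exec, hr.ne]
  · rw [I.run_append]; simp [Instr.exec]
  · rcases hw with rfl | hw
    · right; intro I; rw [I.run_append]; simp [Instr.exec, ea, eb]
    · exact Or.inl hw

theorem Der.combY {S : Known mx Lx Lxy Ly Dx Dy} {u v : ∀ I : Inst mx Lx Lxy Ly Dx Dy, I.F}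
    (hu : u ∈ S.2) (hv : v ∈ S.2) (s t : ℝ) :
    Der 0 S (S.1, insert (fun I => s • u I + t • v I) S.2) := by
  refine Der.of_instr (by exact subset_rfl) (Set.subset_insert _ _) fun P N hP => ?_
  obtain ⟨a, ha, ea⟩ := hP.2 u hu
  obtain ⟨b, hb, eb⟩ := hP.2 v hv
  refine ⟨.combY N s a t b, le_rfl, fun I r hr => ?_, fun I r hr => ?_,
    fun w hw => Or.inl hw, fun w hw => ?_⟩
  · rw [I.run_append]; simp [Instr.exec]
  · rw [I.run_append]; simp [Instr.exec, hr.ne]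
  · rcases hw with rfl | hw
    · right; intro I; rw [I.run_append]; simp [Instr.exec, ea, eb]
    · exact Or.inl hw

theorem Der.projX {S : Known mx Lx Lxy Ly Dx Dy} {u : ∀ I : Inst mx Lx Lxy Ly Dx Dy, I.E}
    (hu : u ∈ S.1) : Der 0 S (insert (fun I => proj I.X (u I)) S.1, S.2) := by
  refine Der.of_instr (Set.subset_insert _ _) (by exact subset_rfl) fun P N hP => ?_
  obtain ⟨a, ha, ea⟩ := hP.1 u hu
  refine ⟨.projX N a, le_rfl, fun I r hr => ?_, fun I r hr => ?_, fun w hw => ?_,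
    fun w hw => Or.inl hw⟩
  · rw [I.run_append]; simp [Instr.exec, hr.ne]
  · rw [I.run_append]; simp [Instr.exec]
  · rcases hw with rfl | hw
    · right; intro I; rw [I.run_append]; simp [Instr.exec, ea]
    · exact Or.inl hw

theorem Der.projY {S : Known mx Lx Lxy Ly Dx Dy} {u : ∀ I : Inst mx Lx Lxy Ly Dx Dy, I.F}
    (hu : u ∈ S.2) : Der 0 S (S.1, insert (fun I => proj I.Y (u I)) S.2) := by
  refine Der.of_instr (by exact subset_rfl) (Set.subset_insert _ _) fun P N hP => ?_
  obtain ⟨a, ha, ea⟩ := hP.2 u hu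
  refine ⟨.projY N a, le_rfl, fun I r hr => ?_, fun I r hr => ?_,
    fun w hw => Or.inl hw, fun w hw => ?_⟩
  · rw [I.run_append]; simp [Instr.exec]
  · rw [I.run_append]; simp [Instr.exec, hr.ne]
  · rcases hw with rfl | hw
    · right; intro I; rw [I.run_append]; simp [Instr.exec, ea]
    · exact Or.inl hw

theorem Der.grad {S : Known mx Lx Lxy Ly Dx Dy} {u : ∀ I : Inst mx Lx Lxy Ly Dx Dy, I.E}
    {v : ∀ I : Inst mx Lx Lxy Ly Dx Dy, I.F} (hu : u ∈ S.1) (hv : v ∈ S.2) :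
    Der 1 S (insert (fun I => gradX I.f (u I) (v I)) S.1,
      insert (fun I => gradY I.f (u I) (v I)) S.2) := by
  refine Der.of_instr (Set.subset_insert _ _) (Set.subset_insert _ _) fun P N hP => ?_
  obtain ⟨a, ha, ea⟩ := hP.1 u hu
  obtain ⟨b, hb, eb⟩ := hP.2 v hv
  refine ⟨.grad N N a b, le_rfl, fun I r hr => ?_, fun I r hr => ?_,
    fun w hw => ?_, fun w hw => ?_⟩
  · rw [I.run_append]; simp [Instr.exec, hr.ne]
  · rw [I.run_append]; simp [Instr.exec, hr.ne]
  · rcases hw with rfl | hw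
    · right; intro I; rw [I.run_append]; simp [Instr.exec, ea, eb]
    · exact Or.inl hw
  · rcases hw with rfl | hw
    · right; intro I; rw [I.run_append]; simp [Instr.exec, ea, eb]
    · exact Or.inl hw

/-- The initial points. -/
def initial : Known mx Lx Lxy Ly Dx Dy := ({fun I => I.x₀}, {fun I => I.y₀})

/-- Vectors that can be computed from the initial points are the output of a method. -/
theorem Der.exists_method {c : ℕ} {S : Known mx Lx Lxy Ly Dx Dy} (h : Der c initial S)
    {u : ∀ I : Inst mx Lx Lxy Ly Dx Dy, I.E} {v : ∀ I : Inst mx Lx Lxy Ly Dx Dy, I.F}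
    (hu : u ∈ S.1) (hv : v ∈ S.2) : ∃ P : Method, Method.gradCount P ≤ c ∧
      ∀ I : Inst mx Lx Lxy Ly Dx Dy, Method.outX I.X I.Y I.f P I.x₀ I.y₀ = u I ∧
        Method.outY I.X I.Y I.f P I.x₀ I.y₀ = v I := by
  -- The empty program holds the initial points in register `0`, hence the bound `1`. Two final
  -- copies, free of gradients, move the results back to register `0`.
  obtain ⟨P, N, hc, hP⟩ := h.2.2 [] 1
    ⟨by rintro _ rfl; exact ⟨0, by simp, fun I => rfl⟩,
      by rintro _ rfl; exact ⟨0, by simp, fun I => rfl⟩⟩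
  obtain ⟨a, -, ea⟩ := hP.1 u hu
  obtain ⟨b, -, eb⟩ := hP.2 v hv
  refine ⟨P ++ [.combX 0 1 a 0 a] ++ [.combY 0 1 b 0 b], ?_, fun I => ?_⟩
  · rw [gradCount_append, gradCount_append]
    simpa [Instr.cost, Method.gradCount] using hc
  · change (I.run _).1 0 = _ ∧ (I.run _).2 0 = _
    rw [I.run_append, I.run_append]
    simp [Instr.exec, ea, eb]

end Programs

/-! ### The inexact accelerated method in an abstract computational system. -/

noncomputable section Solvers

/-- The number of iterations of a method with condition number `κ`. -/
def iters (R κ : ℝ) : ℕ := ⌈400 * √κ * Real.log R⌉₊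

/-- The base is `1 - 1 / (4 * √κ)`, at most `exp (-1 / (4 * √κ))`; the factor `400` in `iters` is `4
* 100`. -/
theorem one_sub_pow_le {R κ : ℝ} (hR : 3 ≤ R) (hκ : 1 ≤ κ) :
    (1 - 1 / (2 * √κ) / 2) ^ iters R κ ≤ 1 / R ^ 100 := by
  have hs : 1 ≤ √κ := Real.one_le_sqrt.2 hκ
  set K := iters R κ with hK
  have h1 : 1 - 1 / (2 * √κ) / 2 ≤ Real.exp (-(1 / (4 * √κ))) := by
    have := Real.add_one_le_exp (-(1 / (4 * √κ)))
    have e : 1 / (2 * √κ) / 2 = 1 / (4 * √κ) := by field_simp; norm_num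
    rw [e]; linarith
  have h0 : 0 ≤ 1 - 1 / (2 * √κ) / 2 := by
    have : 1 / (2 * √κ) ≤ 1 := by rw [div_le_one (by positivity)]; linarith
    linarith
  have h2 : 400 * √κ * Real.log R ≤ K := Nat.le_ceil _
  calc (1 - 1 / (2 * √κ) / 2) ^ K ≤ Real.exp (-(1 / (4 * √κ))) ^ K := pow_le_pow_left₀ h0 h1 _
    _ = Real.exp (-(K / (4 * √κ))) := by rw [← Real.exp_nat_mul]; congr 1; ring
    _ ≤ Real.exp (-(Real.log R * 100)) := by
        apply Real.exp_le_exp.2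
        apply neg_le_neg
        rw [le_div_iff₀ (by positivity)]
        linarith
    _ = 1 / R ^ 100 := by
        have e : Real.exp (Real.log R * 100) = R ^ 100 := by
          rw [mul_comm, show (100 : ℝ) = ((100 : ℕ) : ℝ) by norm_num, Real.exp_nat_mul,
            Real.exp_log (by linarith)]
        rw [Real.exp_neg, e, one_div]

/-- Bookkeeping of powers of `R`. The accumulated oracle error is `4 * κ * δ`, and `κ ≤ R ^ 3` uses
three of the six spare powers in `δ`. The initial error needs `R ^ 100` to beat `R ^ 3 * R ^ (2 *
j)`, which holds with room for `j ≤ 40`. -/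
theorem accuracy_le {R D κ δ w d : ℝ} {j : ℕ} (hR : 3 ≤ R) (hD : 0 ≤ D) (hκ : 1 ≤ κ)
    (hκR : κ ≤ R ^ 3) (hj : j ≤ 40) (hδ0 : 0 ≤ δ) (hδ : δ ≤ D / R ^ (j + 6))
    (hw : w ≤ 1 / R ^ 100)
    (hd : d ^ 2 ≤ κ * D ^ 2 * w + 16 * κ ^ 2 * δ ^ 2) : δ + d ≤ D / R ^ j := by
  have hR0 : 0 < R := by linarith
  set B := D / R ^ j with hB
  have hB0 : 0 ≤ B := by positivity
  have h3 : (3 : ℝ) ^ 6 ≤ R ^ 6 := pow_le_pow_left₀ (by norm_num) hR 6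
  have hDB : D = B * R ^ j := by rw [hB]; field_simp
  have hδB : δ * R ^ 6 ≤ B := by
    have : D / R ^ (j + 6) = B / R ^ 6 := by rw [hB, pow_add]; field_simp
    rw [this, le_div_iff₀ (by positivity)] at hδ
    exact hδ
  have hδ1 : 729 * δ ≤ B := by nlinarith
  have t1 : κ * D ^ 2 * w ≤ B ^ 2 / 9 := by
    have hw' : κ * D ^ 2 * w ≤ R ^ 3 * D ^ 2 * (1 / R ^ 100) := by
      calc κ * D ^ 2 * w ≤ κ * D ^ 2 * (1 / R ^ 100) := mul_le_mul_of_nonneg_left hw (by positivity)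
        _ ≤ _ := by gcongr
    have e : R ^ 3 * D ^ 2 * (1 / R ^ 100) = B ^ 2 * (R ^ (2 * j) / R ^ 97) := by
      rw [hDB]; field_simp; ring
    have h97 : R ^ (2 * j) / R ^ 97 ≤ 1 / 9 := by
      rw [div_le_div_iff₀ (by positivity) (by positivity)]
      have : R ^ (2 * j) ≤ R ^ 80 := pow_le_pow_right₀ (by linarith) (by omega)
      have h17 : (9 : ℝ) ≤ R ^ 17 := by
        calc (9 : ℝ) ≤ 3 ^ 17 := by norm_num
          _ ≤ R ^ 17 := pow_le_pow_left₀ (by norm_num) hR _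
      calc R ^ (2 * j) * 9 ≤ R ^ 80 * R ^ 17 := by gcongr
        _ = 1 * R ^ 97 := by ring
    rw [e] at hw'
    have := mul_le_mul_of_nonneg_left h97 (sq_nonneg B)
    linarith
  have t2 : 16 * κ ^ 2 * δ ^ 2 ≤ B ^ 2 / 9 := by
    have h1 : κ * δ ≤ R ^ 3 * δ := mul_le_mul_of_nonneg_right hκR hδ0
    have h27 : (3 : ℝ) ^ 3 ≤ R ^ 3 := pow_le_pow_left₀ (by norm_num) hR 3
    have h2 : 27 * (R ^ 3 * δ) ≤ B := by
      have : 27 * (R ^ 3 * δ) ≤ R ^ 3 * (R ^ 3 * δ) :=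
        mul_le_mul_of_nonneg_right (by linarith) (by positivity)
      have e : R ^ 3 * (R ^ 3 * δ) = δ * R ^ 6 := by ring
      linarith
    have h3 : 27 * (κ * δ) ≤ B := by linarith
    have h4 : (27 * (κ * δ)) ^ 2 ≤ B ^ 2 := pow_le_pow_left₀ (by positivity) h3 2
    have e : (27 * (κ * δ)) ^ 2 = 729 / 16 * (16 * κ ^ 2 * δ ^ 2) := by ring
    have : 0 ≤ 16 * κ ^ 2 * δ ^ 2 := by positivity
    linarith
  have hd' : d ≤ B / 2 := by
    apply le_of_sq_le_sq _ (by positivity)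
    have : 0 ≤ B ^ 2 := sq_nonneg B
    calc d ^ 2 ≤ B ^ 2 / 9 + B ^ 2 / 9 := by linarith
      _ ≤ (B / 2) ^ 2 := by linarith
  linarith

/-- The accelerated method with an inexact oracle for a `ProxStep`, in an abstract computational
system: `Dr c S S'` says that `S'` can be computed from `S` at cost `c`, and `av S u` that `u` is
available in `S`. -/
theorem exists_accelerated {ι : Type*} {H : ι → Type*} [∀ i, NormedAddCommGroup (H i)]
    [∀ i, InnerProductSpace ℝ (H i)] [∀ i, CompleteSpace (H i)] {St : Type*}
    {Dr : ℕ → St → St → Prop}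
    {av : St → (∀ i, H i) → Prop}
    (htrans : ∀ {c c' S S' S''}, Dr c S S' → Dr c' S' S'' → Dr (c + c') S S'')
    (hmono : ∀ {c S S' u}, Dr c S S' → av S u → av S' u)
    (hcomb : ∀ {S u v}, av S u → av S v → ∀ s t : ℝ, ∃ S', Dr 0 S S' ∧
      av S' (fun i => s • u i + t • v i))
    {X : ∀ i, Set (H i)} {φ : ∀ i, H i → ℝ} {p : ∀ i, H i → H i} {xs : ∀ i, H i} {β μ R D δ : ℝ}
    (hμ : 0 < μ) (hμβ : μ ≤ β) (hp : ∀ i, ProxStep (X i) (φ i) (p i) β μ)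
    (hxs : ∀ i, IsStrongMin (X i) (φ i) μ (xs i)) (hR : 3 ≤ R) (hκ : β / μ ≤ R ^ 3)
    {S₀ : St} {x₀ : ∀ i, H i} (hx₀ : av S₀ x₀) (hD0 : 0 ≤ D) (hD : ∀ i, ‖x₀ i - xs i‖ ≤ D) {c : ℕ}
    {j : ℕ} (hj : j ≤ 40) (hδ0 : 0 ≤ δ) (hδ : δ ≤ D / R ^ (j + 6)) (hrefl : Dr 0 S₀ S₀)
    (oracle : ∀ {c' S}, Dr c' S₀ S → ∀ {w}, av S w → ∃ S', Dr c S S' ∧ ∃ u, av S' u ∧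
      ∀ i, u i ∈ X i ∧ ‖u i - p i (w i)‖ ≤ δ) :
    ∃ S', Dr ((iters R (β / μ) + 1) * c) S₀ S' ∧ ∃ u, av S' u ∧
      ∀ i, u i ∈ X i ∧ ‖u i - xs i‖ ≤ D / R ^ j := by
  have hβ : 0 < β := hμ.trans_le hμβ
  set κ := β / μ with hκd
  have hκ1 : 1 ≤ κ := (one_le_div hμ).2 hμβ
  have hs : 1 ≤ √κ := Real.one_le_sqrt.2 hκ1
  set α := 1 / (2 * √κ) with hα
  have hα0 : 0 < α := by positivity
  have hα2 : α ≤ 1 / 2 := by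
    rw [hα]; apply one_div_le_one_div_of_le <;> linarith
  have hαβ : 4 * α ^ 2 * β = μ := by
    have : √κ ^ 2 = β / μ := Real.sq_sqrt (by positivity)
    rw [hα, div_pow, mul_pow, this]
    field_simp
    norm_num
  -- Here `x` is the computed point and `a` the exact image of the oracle's target. The constant `8
  -- * β ^ 2 / μ * δ ^ 2` is the fixed point of the error recursion, by `4 * α ^ 2 * β = μ`. One
  -- oracle call before the loop brings the starting potential below `β / 2 * D ^ 2` up to that
  -- error, whence `K + 1` calls.
  have loop : ∀ K : ℕ, ∃ S', Dr ((K + 1) * c) S₀ S' ∧ ∃ x z, av S' x ∧ av S' z ∧ ∀ i, x i ∈ X i ∧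
      ∃ a ∈ X i, ‖x i - a‖ ≤ δ ∧ φ i a - φ i (xs i) + μ / 2 * ‖z i - xs i‖ ^ 2 ≤
        (1 - α / 2) ^ K * (β / 2 * D ^ 2) + 8 * β ^ 2 / μ * δ ^ 2 := by
    intro K
    induction K with
    | zero =>
      obtain ⟨S', hS', u, hu, hui⟩ := oracle hrefl hx₀
      refine ⟨S', by simpa using hS', u, x₀, hu, hmono hS' hx₀, fun i =>
        ⟨(hui i).1, p i (x₀ i), (hp i _).1, (hui i).2, ?_⟩⟩
      have h1 := (hp i (x₀ i)).2 _ (hxs i).1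
      have h2 : ‖x₀ i - xs i‖ ^ 2 ≤ D ^ 2 := pow_le_pow_left₀ (norm_nonneg _) (hD i) 2
      rw [norm_sub_rev (xs i) (x₀ i)] at h1
      have h3 : 0 ≤ β / 2 * ‖xs i - p i (x₀ i)‖ ^ 2 := by positivity
      have h4 : β / 2 * ‖x₀ i - xs i‖ ^ 2 ≤ β / 2 * D ^ 2 :=
        mul_le_mul_of_nonneg_left h2 (by positivity)
      have h5 : 0 ≤ 8 * β ^ 2 / μ * δ ^ 2 := by positivity
      rw [pow_zero, one_mul]
      linarith
    | succ K ih =>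
      obtain ⟨S, hS, x, z, hx, hz, hi⟩ := ih
      obtain ⟨S1, h1, hy⟩ := hcomb hx hz (1 / (1 + α)) (α / (1 + α))
      have hS1 := htrans hS h1
      set y : ∀ i, H i := fun i => (1 / (1 + α)) • x i + (α / (1 + α)) • z i with hyd
      obtain ⟨S2, h2, x', hx', hxi'⟩ := oracle hS1 hy
      have hz2 := hmono h2 (hmono h1 hz)
      have hy2 := hmono h2 hy
      obtain ⟨S3, h3, hc3⟩ := hcomb hz2 hy2 (1 - α) (α - 1 / (4 * α))
      obtain ⟨S4, h4, hc4⟩ := hcomb hc3 (hmono h3 hx') 1 (1 / (4 * α))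
      refine ⟨S4, ?_, x', _, hmono h4 (hmono h3 hx'), hc4, fun i => ⟨(hxi' i).1, p i (y i),
        (hp i _).1, (hxi' i).2, ?_⟩⟩
      · have := htrans (htrans (htrans hS1 h2) h3) h4
        have e : (K + 1) * c + 0 + c + 0 + 0 = (K + 1 + 1) * c := by ring
        rwa [e] at this
      · obtain ⟨-, a, ha, hxa, hV⟩ := hi i
        have hstep := accelerated_step (hp i) hα0 hα2 hβ hαβ (hxs i).1
          (fun u hu => (hxs i).le hμ.le hu) ha hxa (y := y i) (z := z i)
          (by
            have h0 : (1 + α) ≠ 0 := by positivity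
            simp only [hyd, smul_add, smul_smul]
            congr 1
            · rw [mul_one_div_cancel h0, one_smul]
            · congr 1; field_simp) (hxi' i).2
          (z' := (1 : ℝ) • ((1 - α) • z i + (α - 1 / (4 * α)) • y i) + (1 / (4 * α)) • x' i)
          (by module)
        refine hstep.trans ?_
        have h5 := mul_le_mul_of_nonneg_left hV (show (0 : ℝ) ≤ 1 - α / 2 by linarith)
        have e1 : (1 - α / 2) * ((1 - α / 2) ^ K * (β / 2 * D ^ 2) + 8 * β ^ 2 / μ * δ ^ 2) +
            β / α * δ ^ 2 = (1 - α / 2) ^ (K + 1) * (β / 2 * D ^ 2) + 8 * β ^ 2 / μ * δ ^ 2 := by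
          rw [← hαβ]; field_simp; ring
        linarith
  obtain ⟨S', hS', x, z, hx, -, hi⟩ := loop (iters R κ)
  refine ⟨S', hS', x, hx, fun i => ⟨(hi i).1, ?_⟩⟩
  obtain ⟨-, a, ha, hxa, hV⟩ := hi i
  have hg := (hxs i).2 a ha
  have hacc := accuracy_le (d := ‖a - xs i‖) hR hD0 hκ1 hκ hj hδ0 hδ
    (one_sub_pow_le hR hκ1) (by
      have h1 : 0 ≤ μ / 2 * ‖z i - xs i‖ ^ 2 := by positivity
      have h2 : μ / 2 * ‖a - xs i‖ ^ 2 ≤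
        (1 - α / 2) ^ iters R κ * (β / 2 * D ^ 2) + 8 * β ^ 2 / μ * δ ^ 2 := by linarith
      have h3 := mul_le_mul_of_nonneg_left h2 (show 0 ≤ 2 / μ by positivity)
      have e1 : 2 / μ * (μ / 2 * ‖a - xs i‖ ^ 2) = ‖a - xs i‖ ^ 2 := by field_simp
      have e2 : 2 / μ * ((1 - α / 2) ^ iters R κ * (β / 2 * D ^ 2) + 8 * β ^ 2 / μ * δ ^ 2) =
        κ * D ^ 2 * (1 - α / 2) ^ iters R κ + 16 * κ ^ 2 * δ ^ 2 := by
        rw [hκd]; field_simp; ring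
      rwa [e1, e2] at h3)
  have : x i - xs i = (x i - a) + (a - xs i) := by abel
  rw [this]
  exact (norm_add_le _ _).trans (by linarith)

end Solvers

/-! ### Marginal functions and proximal terms as perturbations. -/

section Marginal

variable {E F : Type*} [NormedAddCommGroup E] [InnerProductSpace ℝ E] [CompleteSpace E]
  [NormedAddCommGroup F] [InnerProductSpace ℝ F] [CompleteSpace F]

set_option linter.unusedSectionVars false

/-- The marginal function lies above `h · y` and agrees with it at `x`, so it inherits the growth.
-/
theorem isStrongMin_marginal {X : Set E} {Y : Set F} {h : E → F → ℝ} {μ : ℝ} {x : E} {y : F}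
    (hx : IsStrongMin X (fun u => h u y) μ x) (hy : y ∈ Y) (hmax : ∀ v ∈ Y, h x v ≤ h x y)
    {Yb : E → F} (hYb : ∀ x ∈ X, Yb x ∈ Y ∧ ∀ v ∈ Y, h x v ≤ h x (Yb x)) :
    IsStrongMin X (fun u => h u (Yb u)) μ x := by
  refine ⟨hx.1, fun u hu => ?_⟩
  have h1 := hx.2 u hu
  have h2 := hmax _ (hYb x hx.1).1
  have h3 := (hYb u hu).2 y hy
  simp only at h1 ⊢
  linarith

theorem IsStrongMin.mono {X : Set E} {φ : E → ℝ} {μ ν : ℝ} {x : E} (h : IsStrongMin X φ μ x)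
    (hνμ : ν ≤ μ) : IsStrongMin X φ ν x := by
  refine ⟨h.1, fun u hu => ?_⟩
  have h1 := h.2 u hu
  have h2 : ν / 2 * ‖u - x‖ ^ 2 ≤ μ / 2 * ‖u - x‖ ^ 2 :=
    mul_le_mul_of_nonneg_right (by linarith) (sq_nonneg _)
  linarith

/-- Up to a constant, a proximal term only shifts the parameters of `pert`. Every level of the
nesting is therefore a problem of the same form, with a linear term computable by one combination.
-/
theorem pert_prox_right (f : E → F → ℝ) (a : ℝ) (p : E) (b : ℝ) (q : F) (τ : ℝ) (w : F) (x : E)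
    (y : F) : pert f a p (b + τ) (q + τ • w) x y =
      pert f a p b q x y - τ / 2 * ‖y - w‖ ^ 2 + τ / 2 * ‖w‖ ^ 2 := by
  simp only [pert, inner_add_left, real_inner_smul_left, norm_sub_sq_real, real_inner_comm w]
  ring

theorem pert_prox_left (f : E → F → ℝ) (a : ℝ) (p : E) (b : ℝ) (q : F) (σ : ℝ) (w : E) (x : E)
    (y : F) : pert f (a + σ) (p + σ • w) b q x y =
      pert f a p b q x y + σ / 2 * ‖x - w‖ ^ 2 - σ / 2 * ‖w‖ ^ 2 := by
  simp only [pert, inner_add_left, real_inner_smul_left, norm_sub_sq_real, real_inner_comm w]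
  ring

end Marginal

/-! ### Best responses by accelerated projected gradient. -/

noncomputable section Solvers

variable {mx Lx Lxy Ly Dx Dy R D : ℝ}

/-- The assumptions on the parameters under which the solvers work. -/
structure Admissible (mx Lx Lxy Ly Dx Dy R D : ℝ) : Prop where
  mx_pos : 0 < mx
  mx_le : mx ≤ Lx
  Lxy_nonneg : 0 ≤ Lxy
  Ly_nonneg : 0 ≤ Ly
  three_le : 3 ≤ R
  Dx_le : Dx ≤ D
  Dy_le : Dy ≤ D
  D_nonneg : 0 ≤ D

theorem Inst.dist_left_le (h : Admissible mx Lx Lxy Ly Dx Dy R D) (I : Inst mx Lx Lxy Ly Dx Dy)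
    {x x' : I.E} (hx : x ∈ I.X) (hx' : x' ∈ I.X) : ‖x - x'‖ ≤ D := by
  rw [← dist_eq_norm]
  exact (Metric.dist_le_diam_of_mem I.compactX.isBounded hx hx').trans (I.diamX.trans h.Dx_le)

theorem Inst.dist_right_le (h : Admissible mx Lx Lxy Ly Dx Dy R D) (I : Inst mx Lx Lxy Ly Dx Dy)
    {y y' : I.F} (hy : y ∈ I.Y) (hy' : y' ∈ I.Y) : ‖y - y'‖ ≤ D := by
  rw [← dist_eq_norm]
  exact (Metric.dist_le_diam_of_mem I.compactY.isBounded hy hy').trans (I.diamY.trans h.Dy_le)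

theorem Inst.proxStep_left (h : Admissible mx Lx Lxy Ly Dx Dy R D) (I : Inst mx Lx Lxy Ly Dx Dy)
    {a : ℝ} (ha : 0 ≤ a) (p : I.E) (b : ℝ) (q : I.F) {y : I.F} (hy : y ∈ I.Y) :
    ProxStep I.X (fun u => pert I.f a p b q u y) (fun x => proj I.X (x - (Lx + a)⁻¹ •
      (gradX I.f (proj I.X x) y + (a • proj I.X x - p)))) (Lx + a) ((mx + a) / 2) :=
  proxStep_projGrad (G := fun x => gradX I.f x y + (a • x - p)) ⟨_, I.memX⟩ I.compactX.isComplete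
    I.convexX (by linarith [h.mx_pos, h.mx_le])
    (by linarith [h.mx_pos]) (by linarith [h.mx_le])
    (I.scc.strongConvexOn_pert_left a p b q hy)
    (fun _ hx => I.scc.smooth.hasGradientAt_pert_left a p b q hx hy)
    (I.scc.smooth.lip_pert_left a p ha hy)

theorem Inst.proxStep_right (h : Admissible mx Lx Lxy Ly Dx Dy R D) (I : Inst mx Lx Lxy Ly Dx Dy)
    (a : ℝ) (p : I.E) {b : ℝ} (hb : 0 < b) (q : I.F) {x : I.E} (hx : x ∈ I.X) :
    ProxStep I.Y (fun v => -pert I.f a p b q x v) (fun y => proj I.Y (y - (Ly + b)⁻¹ •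
      (-gradY I.f x (proj I.Y y) + (b • proj I.Y y - q)))) (Ly + b) (b / 2) :=
  proxStep_projGrad (G := fun y => -gradY I.f x y + (b • y - q)) ⟨_, I.memY⟩
    I.compactY.isComplete I.convexY (by linarith [h.Ly_nonneg])
    (by linarith) (by linarith [h.Ly_nonneg])
    (I.scc.strongConvexOn_pert_right a p b q hx)
    (fun _ hy => I.scc.smooth.hasGradientAt_pert_right a p b q hx hy)
    (I.scc.smooth.lip_pert_right b q hb.le hx)

variable {S₀ : Known mx Lx Lxy Ly Dx Dy}

theorem Der.projGrad_left (a L : ℝ) {p w : ∀ I : Inst mx Lx Lxy Ly Dx Dy, I.E}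
    {y : ∀ I : Inst mx Lx Lxy Ly Dx Dy, I.F} (hp : p ∈ S₀.1) (hw : w ∈ S₀.1) (hy : y ∈ S₀.2) :
    ∃ S, Der 1 S₀ S ∧ (fun I => proj I.X (w I - L⁻¹ •
      (gradX I.f (proj I.X (w I)) (y I) + (a • proj I.X (w I) - p I)))) ∈ S.1 := by
  obtain ⟨S1, d1, m1⟩ : ∃ S, Der 0 S₀ S ∧ (fun I => proj I.X (w I)) ∈ S.1 :=
    ⟨_, Der.projX hw, Set.mem_insert _ _⟩
  obtain ⟨S2, d2, m2⟩ : ∃ S, Der 1 S1 S ∧ (fun I => gradX I.f (proj I.X (w I)) (y I)) ∈ S.1 :=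
    ⟨_, Der.grad m1 (d1.2.1 hy), Set.mem_insert _ _⟩
  obtain ⟨S3, d3, m3⟩ : ∃ S, Der 0 S2 S ∧ (fun I => a • proj I.X (w I) + (-1 : ℝ) • p I) ∈ S.1 :=
    ⟨_, Der.combX (d2.1 m1) (d2.1 (d1.1 hp)) _ _, Set.mem_insert _ _⟩
  obtain ⟨S4, d4, m4⟩ : ∃ S, Der 0 S3 S ∧ (fun I => (1 : ℝ) • gradX I.f (proj I.X (w I)) (y I) +
      (1 : ℝ) • (a • proj I.X (w I) + (-1 : ℝ) • p I)) ∈ S.1 :=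
    ⟨_, Der.combX (d3.1 m2) m3 _ _, Set.mem_insert _ _⟩
  obtain ⟨S5, d5, m5⟩ : ∃ S, Der 0 S4 S ∧ (fun I => (1 : ℝ) • w I + (-L⁻¹) • ((1 : ℝ) • gradX I.f (proj I.X (w I)) (y I) +
      (1 : ℝ) • (a • proj I.X (w I) + (-1 : ℝ) • p I))) ∈ S.1 :=
    ⟨_, Der.combX (d4.1 (d3.1 (d2.1 (d1.1 hw)))) m4 _ _, Set.mem_insert _ _⟩
  refine ⟨_, ((((d1.trans d2).trans d3).trans d4).trans d5).trans (Der.projX m5), ?_⟩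
  refine Set.mem_insert_iff.2 (Or.inl ?_)
  funext I
  congr 1
  module

theorem Der.projGrad_right (b L : ℝ) {q w : ∀ I : Inst mx Lx Lxy Ly Dx Dy, I.F}
    {x : ∀ I : Inst mx Lx Lxy Ly Dx Dy, I.E} (hq : q ∈ S₀.2) (hw : w ∈ S₀.2) (hx : x ∈ S₀.1) :
    ∃ S, Der 1 S₀ S ∧ (fun I => proj I.Y (w I - L⁻¹ •
      (-gradY I.f (x I) (proj I.Y (w I)) + (b • proj I.Y (w I) - q I)))) ∈ S.2 := by
  obtain ⟨S1, d1, m1⟩ : ∃ S, Der 0 S₀ S ∧ (fun I => proj I.Y (w I)) ∈ S.2 :=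
    ⟨_, Der.projY hw, Set.mem_insert _ _⟩
  obtain ⟨S2, d2, m2⟩ : ∃ S, Der 1 S1 S ∧ (fun I => gradY I.f (x I) (proj I.Y (w I))) ∈ S.2 :=
    ⟨_, Der.grad (d1.1 hx) m1, Set.mem_insert _ _⟩
  obtain ⟨S3, d3, m3⟩ : ∃ S, Der 0 S2 S ∧ (fun I => b • proj I.Y (w I) + (-1 : ℝ) • q I) ∈ S.2 :=
    ⟨_, Der.combY (d2.2.1 m1) (d2.2.1 (d1.2.1 hq)) _ _, Set.mem_insert _ _⟩
  obtain ⟨S4, d4, m4⟩ : ∃ S, Der 0 S3 S ∧ (fun I => (-1 : ℝ) • gradY I.f (x I) (proj I.Y (w I)) +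
      (1 : ℝ) • (b • proj I.Y (w I) + (-1 : ℝ) • q I)) ∈ S.2 :=
    ⟨_, Der.combY (d3.2.1 m2) m3 _ _, Set.mem_insert _ _⟩
  obtain ⟨S5, d5, m5⟩ : ∃ S, Der 0 S4 S ∧ (fun I => (1 : ℝ) • w I + (-L⁻¹) • ((-1 : ℝ) • gradY I.f (x I) (proj I.Y (w I)) +
      (1 : ℝ) • (b • proj I.Y (w I) + (-1 : ℝ) • q I))) ∈ S.2 :=
    ⟨_, Der.combY (d4.2.1 (d3.2.1 (d2.2.1 (d1.2.1 hw)))) m4 _ _, Set.mem_insert _ _⟩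
  refine ⟨_, ((((d1.trans d2).trans d3).trans d4).trans d5).trans (Der.projY m5), ?_⟩
  refine Set.mem_insert_iff.2 (Or.inl ?_)
  funext I
  congr 1
  module

/-- The vectors include the initial points. -/
def HasInit (S : Known mx Lx Lxy Ly Dx Dy) : Prop := (fun I => I.x₀) ∈ S.1 ∧ (fun I => I.y₀) ∈ S.2

theorem HasInit.mono {S S' : Known mx Lx Lxy Ly Dx Dy} {c : ℕ} (hS : HasInit S) (h : Der c S S') :
    HasInit S' := ⟨h.1 hS.1, h.2.1 hS.2⟩

/-- The accelerated method in the space of `x`. -/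
theorem exists_accelerated_left (h : Admissible mx Lx Lxy Ly Dx Dy R D)
    {φ : ∀ I : Inst mx Lx Lxy Ly Dx Dy, I.E → ℝ}
    {p : ∀ I : Inst mx Lx Lxy Ly Dx Dy, I.E → I.E} {xs : ∀ I : Inst mx Lx Lxy Ly Dx Dy, I.E}
    {β μ δ : ℝ} (hμ : 0 < μ) (hμβ : μ ≤ β) (hp : ∀ I, ProxStep I.X (φ I) (p I) β μ)
    (hxs : ∀ I, IsStrongMin I.X (φ I) μ (xs I)) (hκ : β / μ ≤ R ^ 3) (hS₀ : HasInit S₀) {c j : ℕ}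
    (hj : j ≤ 40) (hδ0 : 0 ≤ δ) (hδ : δ ≤ D / R ^ (j + 6))
    (oracle : ∀ {c' S}, Der c' S₀ S → ∀ {w}, w ∈ S.1 → ∃ S', Der c S S' ∧ ∃ u ∈ S'.1,
      ∀ I, u I ∈ I.X ∧ ‖u I - p I (w I)‖ ≤ δ) :
    ∃ S', Der ((iters R (β / μ) + 1) * c) S₀ S' ∧ ∃ u ∈ S'.1,
      ∀ I, u I ∈ I.X ∧ ‖u I - xs I‖ ≤ D / R ^ j :=
  exists_accelerated (ι := Inst mx Lx Lxy Ly Dx Dy) (H := fun I => I.E) (Dr := Der)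
    (av := fun S u => u ∈ S.1) (X := fun I => I.X) (x₀ := fun I => I.x₀)
    Der.trans (fun h hu => h.1 hu)
    (fun hu hv s t => ⟨_, Der.combX hu hv s t, Set.mem_insert _ _⟩) hμ hμβ hp hxs h.three_le hκ
    hS₀.1 h.D_nonneg (fun I => I.dist_left_le h I.memX (hxs I).1) hj hδ0 hδ (Der.refl _) oracle

/-- The accelerated method in the space of `y`. -/
theorem exists_accelerated_right (h : Admissible mx Lx Lxy Ly Dx Dy R D)
    {φ : ∀ I : Inst mx Lx Lxy Ly Dx Dy, I.F → ℝ}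
    {p : ∀ I : Inst mx Lx Lxy Ly Dx Dy, I.F → I.F} {ys : ∀ I : Inst mx Lx Lxy Ly Dx Dy, I.F}
    {β μ δ : ℝ} (hμ : 0 < μ) (hμβ : μ ≤ β) (hp : ∀ I, ProxStep I.Y (φ I) (p I) β μ)
    (hys : ∀ I, IsStrongMin I.Y (φ I) μ (ys I)) (hκ : β / μ ≤ R ^ 3) (hS₀ : HasInit S₀) {c j : ℕ}
    (hj : j ≤ 40) (hδ0 : 0 ≤ δ) (hδ : δ ≤ D / R ^ (j + 6))
    (oracle : ∀ {c' S}, Der c' S₀ S → ∀ {w}, w ∈ S.2 → ∃ S', Der c S S' ∧ ∃ u ∈ S'.2,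
      ∀ I, u I ∈ I.Y ∧ ‖u I - p I (w I)‖ ≤ δ) :
    ∃ S', Der ((iters R (β / μ) + 1) * c) S₀ S' ∧ ∃ u ∈ S'.2,
      ∀ I, u I ∈ I.Y ∧ ‖u I - ys I‖ ≤ D / R ^ j :=
  exists_accelerated (ι := Inst mx Lx Lxy Ly Dx Dy) (H := fun I => I.F) (Dr := Der)
    (av := fun S u => u ∈ S.2) (X := fun I => I.Y) (x₀ := fun I => I.y₀)
    Der.trans (fun h hu => h.2.1 hu)
    (fun hu hv s t => ⟨_, Der.combY hu hv s t, Set.mem_insert _ _⟩) hμ hμβ hp hys h.three_le hκ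
    hS₀.2 h.D_nonneg (fun I => I.dist_right_le h I.memY (hys I).1) hj hδ0 hδ (Der.refl _) oracle

/-- Computing a best response in `x`. -/
theorem solve_left (h : Admissible mx Lx Lxy Ly Dx Dy R D) {a : ℝ} (ha : 0 ≤ a)
    (hκ : (Lx + a) / ((mx + a) / 2) ≤ R ^ 3) (hS₀ : HasInit S₀)
    {p : ∀ I : Inst mx Lx Lxy Ly Dx Dy, I.E} (hp : p ∈ S₀.1)
    {y : ∀ I : Inst mx Lx Lxy Ly Dx Dy, I.F} (hy : y ∈ S₀.2) (hyY : ∀ I, y I ∈ I.Y) {b : ℝ}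
    {q : ∀ I : Inst mx Lx Lxy Ly Dx Dy, I.F} {xs : ∀ I : Inst mx Lx Lxy Ly Dx Dy, I.E}
    (hxs : ∀ I, IsStrongMin I.X (fun u => pert I.f a (p I) b (q I) u (y I)) (mx + a) (xs I))
    {j : ℕ} (hj : j ≤ 40) :
    ∃ S', Der (iters R ((Lx + a) / ((mx + a) / 2)) + 1) S₀ S' ∧ ∃ u ∈ S'.1,
      ∀ I, u I ∈ I.X ∧ ‖u I - xs I‖ ≤ D / R ^ j := by
  have hm : 0 < mx + a := by linarith [h.mx_pos]
  have hR : 0 < R := by linarith [h.three_le]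
  -- The oracle is an exact projected gradient step costing one gradient; the halved modulus comes
  -- from `proxStep_projGrad`.
  have := exists_accelerated_left (S₀ := S₀) (c := 1) (δ := 0) h (half_pos hm)
    (by linarith [h.mx_le])
    (fun I => I.proxStep_left h ha (p I) b (q I) (hyY I)) (fun I => (hxs I).mono (by linarith))
    hκ hS₀ hj le_rfl (div_nonneg h.D_nonneg (by positivity))
    (fun {c' S} hS {w} hw => by
      obtain ⟨S', h1, h2⟩ := Der.projGrad_left a (Lx + a) (hS.1 hp) hw (hS.2.1 hy)
      refine ⟨S', h1, _, h2, fun I => ⟨(I.proxStep_left h ha (p I) b (q I) (hyY I) (w I)).1, ?_⟩⟩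
      simp)
  simpa using this

/-- Computing a best response in `y`. -/
theorem solve_right (h : Admissible mx Lx Lxy Ly Dx Dy R D) {b : ℝ} (hb : 0 < b)
    (hκ : (Ly + b) / (b / 2) ≤ R ^ 3) (hS₀ : HasInit S₀)
    {q : ∀ I : Inst mx Lx Lxy Ly Dx Dy, I.F} (hq : q ∈ S₀.2)
    {x : ∀ I : Inst mx Lx Lxy Ly Dx Dy, I.E} (hx : x ∈ S₀.1) (hxX : ∀ I, x I ∈ I.X) {a : ℝ}
    {p : ∀ I : Inst mx Lx Lxy Ly Dx Dy, I.E} {ys : ∀ I : Inst mx Lx Lxy Ly Dx Dy, I.F}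
    (hys : ∀ I, IsStrongMin I.Y (fun v => -pert I.f a (p I) b (q I) (x I) v) b (ys I))
    {j : ℕ} (hj : j ≤ 40) :
    ∃ S', Der (iters R ((Ly + b) / (b / 2)) + 1) S₀ S' ∧ ∃ u ∈ S'.2,
      ∀ I, u I ∈ I.Y ∧ ‖u I - ys I‖ ≤ D / R ^ j := by
  have hR : 0 < R := by linarith [h.three_le]
  have := exists_accelerated_right (S₀ := S₀) (c := 1) (δ := 0) h (half_pos hb)
    (by linarith [h.Ly_nonneg])
    (fun I => I.proxStep_right h a (p I) hb (q I) (hxX I)) (fun I => (hys I).mono (by linarith))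
    hκ hS₀ hj le_rfl (div_nonneg h.D_nonneg (by positivity))
    (fun {c' S} hS {w} hw => by
      obtain ⟨S', h1, h2⟩ := Der.projGrad_right b (Ly + b) (hS.2.1 hq) hw (hS.1 hx)
      refine ⟨S', h1, _, h2, fun I => ⟨(I.proxStep_right h a (p I) hb (q I) (hxX I) (w I)).1, ?_⟩⟩
      simp)
  simpa using this

end Solvers

/-! ### Alternating best responses and the two nested proximal methods. -/

noncomputable section NestedSolvers

variable {mx Lx Lxy Ly Dx Dy R D : ℝ} {S₀ : Known mx Lx Lxy Ly Dx Dy}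

/-- Alternating best responses, for a weak coupling of `x` and `y`. -/
theorem solve_alternating (h : Admissible mx Lx Lxy Ly Dx Dy R D) {a b : ℝ} (ha : 0 ≤ a)
    (hb : 0 < b) (hxc : 2 * Lxy ≤ mx + a) (hyc : 2 * Lxy ≤ b)
    (hκx : (Lx + a) / ((mx + a) / 2) ≤ R ^ 3) (hκy : (Ly + b) / (b / 2) ≤ R ^ 3)
    (hS₀ : HasInit S₀) {p : ∀ I : Inst mx Lx Lxy Ly Dx Dy, I.E} (hp : p ∈ S₀.1)
    {q : ∀ I : Inst mx Lx Lxy Ly Dx Dy, I.F} (hq : q ∈ S₀.2)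
    {xs : ∀ I : Inst mx Lx Lxy Ly Dx Dy, I.E} {ys : ∀ I : Inst mx Lx Lxy Ly Dx Dy, I.F}
    (hs : ∀ I, IsStrongSaddle I.X I.Y (pert I.f a (p I) b (q I)) (mx + a) b (xs I) (ys I))
    {j : ℕ} (hj : j ≤ 30) :
    ∃ S', Der (iters R 1 * ((iters R ((Lx + a) / ((mx + a) / 2)) + 1) +
      (iters R ((Ly + b) / (b / 2)) + 1))) S₀ S' ∧
      ∃ v ∈ S'.2, ∀ I, v I ∈ I.Y ∧ ‖v I - ys I‖ ≤ D / R ^ j := by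
  have hm : 0 < mx + a := by linarith [h.mx_pos]
  have hR3 := h.three_le
  have hR : 0 < R := by linarith
  have hD := h.D_nonneg
  set c := (iters R ((Lx + a) / ((mx + a) / 2)) + 1) + (iters R ((Ly + b) / (b / 2)) + 1) with hc
  set δ := D / R ^ (j + 1) with hδ
  have hδ0 : 0 ≤ δ := by positivity
  -- One round turns an error `e` in `y` into at most `e / 4 + 3 / 2 * δ`, and `2 * δ` is the fixed
  -- point of this recursion.
  have loop : ∀ T : ℕ, ∃ S', Der (T * c) S₀ S' ∧ ∃ v ∈ S'.2, ∀ I, v I ∈ I.Y ∧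
      ‖v I - ys I‖ ≤ D * (1 / 4) ^ T + 2 * δ := by
    intro T
    induction T with
    | zero =>
      refine ⟨S₀, by simpa using Der.refl S₀, _, hS₀.2, fun I => ⟨I.memY, ?_⟩⟩
      have := I.dist_right_le h I.memY (hs I).2.1
      simp only [pow_zero, mul_one]
      linarith
    | succ T ih =>
      obtain ⟨S, hS, v, hv, hvi⟩ := ih
      choose xb hxb using fun I : Inst mx Lx Lxy Ly Dx Dy =>
        I.scc.exists_best_left a (p I) b (q I) I.compactX ⟨_, I.memX⟩ (hvi I).1
      obtain ⟨S1, h1, u, hu, hui⟩ := solve_left h ha hκx (hS₀.mono hS) (hS.1 hp) hv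
        (fun I => (hvi I).1) hxb (show j + 1 ≤ 40 by omega)
      have hS1 := hS.trans h1
      choose yb hyb using fun I : Inst mx Lx Lxy Ly Dx Dy =>
        I.scc.exists_best_right a (p I) b (q I) I.compactY ⟨_, I.memY⟩ (hui I).1
      obtain ⟨S2, h2, w, hw, hwi⟩ := solve_right h hb hκy (hS₀.mono hS1) (hS1.2.1 hq) hu
        (fun I => (hui I).1) hyb (show j + 1 ≤ 40 by omega)
      refine ⟨S2, ?_, w, hw, fun I => ⟨(hwi I).1, ?_⟩⟩
      · have := hS1.trans h2
        have e : (T + 1) * c = T * c + (iters R ((Lx + a) / ((mx + a) / 2)) + 1) +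
          (iters R ((Ly + b) / (b / 2)) + 1) := by rw [hc]; ring
        rwa [e]
      · have k1 := I.scc.best_left_lipschitz a (p I) b (q I) I.convexX hm h.Lxy_nonneg (hvi I).1
          (hs I).2.1 (hxb I) (hs I).1
        have k2 := I.scc.best_right_lipschitz a (p I) b (q I) I.convexX hb h.Lxy_nonneg (hui I).1
          (hs I).1.1 (hyb I) (hs I).2
        have l1 : Lxy / (mx + a) ≤ 1 / 2 := by rw [div_le_div_iff₀ hm two_pos]; linarith
        have l2 : Lxy / b ≤ 1 / 2 := by rw [div_le_div_iff₀ hb two_pos]; linarith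
        have k1' : ‖xb I - xs I‖ ≤ 1 / 2 * ‖v I - ys I‖ :=
          k1.trans (mul_le_mul_of_nonneg_right l1 (norm_nonneg _))
        have k2' : ‖yb I - ys I‖ ≤ 1 / 2 * ‖u I - xs I‖ :=
          k2.trans (mul_le_mul_of_nonneg_right l2 (norm_nonneg _))
        have k3 := (hui I).2
        have k4 := (hwi I).2
        have k5 := (hvi I).2
        have t1 := norm_sub_le_norm_sub_add_norm_sub (u I) (xb I) (xs I)
        have t2 := norm_sub_le_norm_sub_add_norm_sub (w I) (yb I) (ys I)
        rw [pow_succ]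
        linarith
  obtain ⟨S', hS', v, hv, hvi⟩ := loop (iters R 1)
  refine ⟨S', hS', v, hv, fun I => ⟨(hvi I).1, (hvi I).2.trans ?_⟩⟩
  -- For `κ = 1` the rate in `one_sub_pow_le` is `3 / 4`, which is worse than the `1 / 4` available
  -- here.
  have e1 : ((1 : ℝ) / 4) ^ iters R 1 ≤ 1 / R ^ (j + 1) := by
    have h1 := one_sub_pow_le hR3 le_rfl
    have h2 : ((1 : ℝ) / 4) ^ iters R 1 ≤ (1 - 1 / (2 * √1) / 2) ^ iters R 1 :=
      pow_le_pow_left₀ (by norm_num) (by norm_num) _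
    refine (h2.trans h1).trans ?_
    apply one_div_le_one_div_of_le (by positivity)
    exact pow_le_pow_right₀ (by linarith) (by omega)
  have e2 := mul_le_mul_of_nonneg_left e1 hD
  have e3 : D / R ^ j = δ * R := by rw [hδ, pow_succ]; field_simp
  have e4 : D * (1 / R ^ (j + 1)) = δ := by rw [hδ]; ring
  have e5 : δ * 3 ≤ δ * R := mul_le_mul_of_nonneg_left hR3 hδ0
  linarith

/-- The cost of `solve_prox_right`. -/
def costInner (mx Lx Ly R a b τ : ℝ) : ℕ :=
  (iters R (τ / (b / 2)) + 1) * (iters R 1 * ((iters R ((Lx + a) / ((mx + a) / 2)) + 1) +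
    (iters R ((Ly + (b + τ)) / ((b + τ) / 2)) + 1))) + (iters R ((Lx + a) / ((mx + a) / 2)) + 1)

/-- The accelerated proximal point method in `y`. -/
theorem solve_prox_right (h : Admissible mx Lx Lxy Ly Dx Dy R D) {a b τ : ℝ} (ha : 0 ≤ a)
    (hb : 0 < b) (hbτ : b ≤ τ) (hxc : 2 * Lxy ≤ mx + a) (hyc : 2 * Lxy ≤ b + τ)
    (hκx : (Lx + a) / ((mx + a) / 2) ≤ R ^ 3) (hκy : (Ly + (b + τ)) / ((b + τ) / 2) ≤ R ^ 3)
    (hκ : τ / (b / 2) ≤ R ^ 3)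
    (hS₀ : HasInit S₀) {p : ∀ I : Inst mx Lx Lxy Ly Dx Dy, I.E} (hp : p ∈ S₀.1)
    {q : ∀ I : Inst mx Lx Lxy Ly Dx Dy, I.F} (hq : q ∈ S₀.2)
    {xs : ∀ I : Inst mx Lx Lxy Ly Dx Dy, I.E} {ys : ∀ I : Inst mx Lx Lxy Ly Dx Dy, I.F}
    (hs : ∀ I, IsStrongSaddle I.X I.Y (pert I.f a (p I) b (q I)) (mx + a) b (xs I) (ys I))
    {j : ℕ} (hj : j ≤ 20) :
    ∃ S', Der (costInner mx Lx Ly R a b τ) S₀ S' ∧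
      ∃ u ∈ S'.1, ∀ I, u I ∈ I.X ∧ ‖u I - xs I‖ ≤ D / R ^ j := by
  have hm : 0 < mx + a := by linarith [h.mx_pos]
  have hR3 := h.three_le
  have hR : 0 < R := by linarith
  have hD := h.D_nonneg
  have hbτ0 : 0 < b + τ := by linarith
  choose xp yp hpr using fun (I : Inst mx Lx Lxy Ly Dx Dy) (w : I.F) =>
    I.scc.exists_isStrongSaddle a (p I) (b + τ) (q I + τ • w) I.compactX I.convexX ⟨_, I.memX⟩
      I.compactY I.convexY ⟨_, I.memY⟩ hm.le hbτ0.le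
  -- The marginal function needs a total choice of best responses; its values off `Y` are
  -- irrelevant.
  have hex : ∀ (I : Inst mx Lx Lxy Ly Dx Dy) (y : I.F), ∃ x, y ∈ I.Y →
      IsStrongMin I.X (fun u => pert I.f a (p I) b (q I) u y) (mx + a) x := fun I y => by
    by_cases hy : y ∈ I.Y
    · obtain ⟨x, hx⟩ := I.scc.exists_best_left a (p I) b (q I) I.compactX ⟨_, I.memX⟩ hy
      exact ⟨x, fun _ => hx⟩
    · exact ⟨I.x₀, fun h => absurd h hy⟩
  choose xb hxb using hex
  have hxb' : ∀ (I : Inst mx Lx Lxy Ly Dx Dy), ∀ y ∈ I.Y, xb I y ∈ I.X ∧ ∀ u ∈ I.X,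
      -pert I.f a (p I) b (q I) u y ≤ -pert I.f a (p I) b (q I) (xb I y) y := fun I y hy =>
    ⟨(hxb I y hy).1, fun u hu => neg_le_neg ((hxb I y hy).le hm.le hu)⟩
  have hstep : ∀ I : Inst mx Lx Lxy Ly Dx Dy, ProxStep I.Y
      (fun y => -pert I.f a (p I) b (q I) (xb I y) y) (yp I) τ (b / 2) := fun I w => by
    obtain ⟨s1, s2⟩ := hpr I w
    refine ⟨s2.1, fun v hv => ?_⟩
    refine prox_saddle_le (h := fun y x => -pert I.f a (p I) b (q I) x y) hb.le hbτ s2.1 s1.1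
      (fun u hu => ?_) (fun v hv => ?_) (hxb' I) hv
    · have := s1.le hm.le hu
      simp only [pert_prox_right] at this
      linarith
    · have := s2.2 v hv
      simp only [pert_prox_right] at this
      linarith
  have hmin : ∀ I : Inst mx Lx Lxy Ly Dx Dy, IsStrongMin I.Y
      (fun y => -pert I.f a (p I) b (q I) (xb I y) y) (b / 2) (ys I) := fun I =>
    (isStrongMin_marginal (h := fun y x => -pert I.f a (p I) b (q I) x y) (hs I).2 (hs I).1.1
      (fun u hu => neg_le_neg ((hs I).1.le hm.le hu)) (hxb' I)).mono (by linarith)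
  obtain ⟨S1, h1, v, hv, hvi⟩ := exists_accelerated_right (S₀ := S₀) h (half_pos hb)
    (show b / 2 ≤ τ by linarith) hstep hmin hκ hS₀ (show j + 1 ≤ 40 by omega)
    (show 0 ≤ D / R ^ (j + 1 + 6) by positivity) le_rfl
    -- The proximal center `w` enters only through the new linear term `q + τ • w`, so this vector
    -- is computed first.
    (fun {c' S} hS {w} hw => by
      have hq' := Der.combY (hS.2.1 hq) hw 1 τ
      have hS' := hS.trans hq'
      obtain ⟨S2, h2, v, hv, hvi⟩ := solve_alternating h (b := b + τ) ha hbτ0 hxc hyc hκx hκy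
        (hS₀.mono hS') (hS'.1 hp) (Set.mem_insert _ _)
        (xs := fun I => xp I (w I)) (ys := fun I => yp I (w I))
        (fun I => by simpa only [one_smul] using hpr I (w I)) (show j + 1 + 6 ≤ 30 by omega)
      exact ⟨S2, by simpa using hq'.trans h2, v, hv, hvi⟩)
  choose x' hx' using fun I : Inst mx Lx Lxy Ly Dx Dy =>
    I.scc.exists_best_left a (p I) b (q I) I.compactX ⟨_, I.memX⟩ (hvi I).1
  obtain ⟨S2, h2, u, hu, hui⟩ := solve_left h ha hκx (hS₀.mono h1) (h1.1 hp) hv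
    (fun I => (hvi I).1) hx' (show j + 1 ≤ 40 by omega)
  refine ⟨S2, h1.trans h2, u, hu, fun I => ⟨(hui I).1, ?_⟩⟩
  have k1 := I.scc.best_left_lipschitz a (p I) b (q I) I.convexX hm h.Lxy_nonneg (hvi I).1
    (hs I).2.1 (hx' I) (hs I).1
  have l1 : Lxy / (mx + a) ≤ 1 / 2 := by rw [div_le_div_iff₀ hm two_pos]; linarith
  have k1' : ‖x' I - xs I‖ ≤ 1 / 2 * ‖v I - ys I‖ :=
    k1.trans (mul_le_mul_of_nonneg_right l1 (norm_nonneg _))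
  have k2 := (hui I).2
  have k3 := (hvi I).2
  have t1 := norm_sub_le_norm_sub_add_norm_sub (u I) (x' I) (xs I)
  have e3 : D / R ^ j = D / R ^ (j + 1) * R := by rw [pow_succ]; field_simp
  have e5 : D / R ^ (j + 1) * 3 ≤ D / R ^ (j + 1) * R :=
    mul_le_mul_of_nonneg_left hR3 (by positivity)
  linarith [norm_nonneg (v I - ys I)]

/-- The cost of `solve_prox_left`. -/
def costOuter (mx Lx Ly R b σ τ : ℝ) : ℕ :=
  (iters R (σ / (mx / 2)) + 1) * costInner mx Lx Ly R σ b τ +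
    (iters R ((Ly + b) / (b / 2)) + 1)

/-- The accelerated proximal point method in `x`, followed by a best response in `y`. -/
theorem solve_prox_left (h : Admissible mx Lx Lxy Ly Dx Dy R D) {b σ τ : ℝ} (hmσ : mx ≤ σ)
    (hb : 0 < b) (hbτ : b ≤ τ) (hxc : 2 * Lxy ≤ mx + σ) (hyc : 2 * Lxy ≤ b + τ)
    (hLb : Lxy / b ≤ R)
    (hκx : (Lx + σ) / ((mx + σ) / 2) ≤ R ^ 3) (hκy : (Ly + (b + τ)) / ((b + τ) / 2) ≤ R ^ 3)
    (hκτ : τ / (b / 2) ≤ R ^ 3) (hκσ : σ / (mx / 2) ≤ R ^ 3) (hκb : (Ly + b) / (b / 2) ≤ R ^ 3)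
    (hS₀ : HasInit S₀) {p : ∀ I : Inst mx Lx Lxy Ly Dx Dy, I.E} (hp : p ∈ S₀.1)
    {q : ∀ I : Inst mx Lx Lxy Ly Dx Dy, I.F} (hq : q ∈ S₀.2)
    {xs : ∀ I : Inst mx Lx Lxy Ly Dx Dy, I.E} {ys : ∀ I : Inst mx Lx Lxy Ly Dx Dy, I.F}
    (hs : ∀ I, IsStrongSaddle I.X I.Y (pert I.f 0 (p I) b (q I)) (mx + 0) b (xs I) (ys I))
    {j : ℕ} (hj : j ≤ 12) :
    ∃ S', Der (costOuter mx Lx Ly R b σ τ) S₀ S' ∧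
      ∃ u ∈ S'.1, ∃ v ∈ S'.2, ∀ I, u I ∈ I.X ∧ v I ∈ I.Y ∧ ‖u I - xs I‖ ≤ D / R ^ j ∧
        ‖v I - ys I‖ ≤ D / R ^ j := by
  have hm := h.mx_pos
  have hR3 := h.three_le
  have hR : 0 < R := by linarith
  have hD := h.D_nonneg
  have hmσ0 : 0 < mx + (0 + σ) := by linarith
  choose xp yp hpr using fun (I : Inst mx Lx Lxy Ly Dx Dy) (w : I.E) =>
    I.scc.exists_isStrongSaddle (0 + σ) (p I + σ • w) b (q I) I.compactX I.convexX ⟨_, I.memX⟩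
      I.compactY I.convexY ⟨_, I.memY⟩ hmσ0.le hb.le
  have hex : ∀ (I : Inst mx Lx Lxy Ly Dx Dy) (x : I.E), ∃ y, x ∈ I.X →
      IsStrongMin I.Y (fun v => -pert I.f 0 (p I) b (q I) x v) b y := fun I x => by
    by_cases hx : x ∈ I.X
    · obtain ⟨y, hy⟩ := I.scc.exists_best_right 0 (p I) b (q I) I.compactY ⟨_, I.memY⟩ hx
      exact ⟨y, fun _ => hy⟩
    · exact ⟨I.y₀, fun h => absurd h hx⟩
  choose yb hyb using hex
  have hyb' : ∀ (I : Inst mx Lx Lxy Ly Dx Dy), ∀ x ∈ I.X, yb I x ∈ I.Y ∧ ∀ v ∈ I.Y,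
      pert I.f 0 (p I) b (q I) x v ≤ pert I.f 0 (p I) b (q I) x (yb I x) := fun I x hx =>
    ⟨(hyb I x hx).1, fun v hv => neg_le_neg_iff.1 ((hyb I x hx).le hb.le hv)⟩
  have hstep : ∀ I : Inst mx Lx Lxy Ly Dx Dy, ProxStep I.X
      (fun x => pert I.f 0 (p I) b (q I) x (yb I x)) (xp I) σ (mx / 2) := fun I w => by
    obtain ⟨s1, s2⟩ := hpr I w
    refine ⟨s1.1, fun u hu => ?_⟩
    refine prox_saddle_le (h := pert I.f 0 (p I) b (q I)) hm.le hmσ s1.1 s2.1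
      (fun v hv => ?_) (fun u hu => ?_) (hyb' I) hu
    · have := s2.le hb.le hv
      simp only [pert_prox_left] at this
      linarith
    · have := s1.2 u hu
      simp only [pert_prox_left] at this
      linarith
  have hmin : ∀ I : Inst mx Lx Lxy Ly Dx Dy, IsStrongMin I.X
      (fun x => pert I.f 0 (p I) b (q I) x (yb I x)) (mx / 2) (xs I) := fun I =>
    (isStrongMin_marginal (h := pert I.f 0 (p I) b (q I)) (hs I).1 (hs I).2.1
      (fun v hv => neg_le_neg_iff.1 ((hs I).2.le hb.le hv)) (hyb' I)).mono (by linarith)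
  obtain ⟨S1, h1, u, hu, hui⟩ := exists_accelerated_left (S₀ := S₀) h (half_pos hm)
    (show mx / 2 ≤ σ by linarith) hstep hmin hκσ hS₀ (show j + 2 ≤ 40 by omega)
    (show 0 ≤ D / R ^ (j + 2 + 6) by positivity) le_rfl
    (fun {c' S} hS {w} hw => by
      have hp' := Der.combX (hS.1 hp) hw 1 σ
      have hS' := hS.trans hp'
      obtain ⟨S2, h2, v, hv, hvi⟩ := solve_prox_right h (a := σ) (by linarith) hb hbτ hxc hyc hκx
        hκy hκτ (hS₀.mono hS') (Set.mem_insert _ _) (hS'.2.1 hq)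
        (xs := fun I => xp I (w I)) (ys := fun I => yp I (w I))
        (fun I => by simpa only [one_smul, zero_add] using hpr I (w I))
        (show j + 2 + 6 ≤ 20 by omega)
      exact ⟨S2, by simpa using hp'.trans h2, v, hv, hvi⟩)
  choose y' hy' using fun I : Inst mx Lx Lxy Ly Dx Dy =>
    I.scc.exists_best_right 0 (p I) b (q I) I.compactY ⟨_, I.memY⟩ (hui I).1
  -- The proximal term in `y` is gone here, so the best response is only `R`-Lipschitz. This is why
  -- `x` is found to accuracy `j + 2`.
  obtain ⟨S2, h2, v, hv, hvi⟩ := solve_right h hb hκb (hS₀.mono h1) (h1.2.1 hq) hu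
    (fun I => (hui I).1) hy' (show j + 2 ≤ 40 by omega)
  have e3 : D / R ^ j = D / R ^ (j + 2) * R * R := by rw [pow_add]; field_simp
  have hB : 0 ≤ D / R ^ (j + 2) := by positivity
  have e5 : D / R ^ (j + 2) * 3 ≤ D / R ^ (j + 2) * R := mul_le_mul_of_nonneg_left hR3 hB
  have e6 : D / R ^ (j + 2) * R * 3 ≤ D / R ^ (j + 2) * R * R :=
    mul_le_mul_of_nonneg_left hR3 (by positivity)
  refine ⟨S2, h1.trans h2, u, h2.1 hu, v, hv, fun I => ⟨(hui I).1, (hvi I).1, ?_, ?_⟩⟩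
  · linarith [(hui I).2]
  · have k1 := I.scc.best_right_lipschitz 0 (p I) b (q I) I.convexX hb h.Lxy_nonneg (hui I).1
      (hs I).1.1 (hy' I) (hs I).2
    have k1' : ‖y' I - ys I‖ ≤ R * (D / R ^ (j + 2)) :=
      k1.trans (mul_le_mul hLb (hui I).2 (norm_nonneg _) hR.le)
    have k2 := (hvi I).2
    have t1 := norm_sub_le_norm_sub_add_norm_sub (v I) (y' I) (ys I)
    linarith

end NestedSolvers

/-! ### From distances to duality gaps. -/

section Gap

variable {E F : Type*} [NormedAddCommGroup E] [InnerProductSpace ℝ E] [CompleteSpace E]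
  [NormedAddCommGroup F] [InnerProductSpace ℝ F] [CompleteSpace F]

set_option linter.unusedSectionVars false

/-- A proximal step moves closer to the minimizer and nearly minimizes. -/
theorem ProxStep.le_of_isStrongMin {X : Set E} {φ : E → ℝ} {p : E → E} {β μ ν : ℝ}
    (hp : ProxStep X φ p β μ) (hβ : 0 < β) (hμ : 0 ≤ μ) (hν : 0 ≤ ν) {xb : E}
    (hxb : IsStrongMin X φ ν xb) {x : E} {r : ℝ} (hr : ‖x - xb‖ ≤ r) :
    ‖p x - xb‖ ≤ r ∧ ∀ u ∈ X, φ (p x) - φ u ≤ β / 2 * r ^ 2 := by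
  obtain ⟨hpX, hpu⟩ := hp x
  have h1 := hpu xb hxb.1
  have h2 := hxb.le hν hpX
  rw [norm_sub_rev xb (p x), norm_sub_rev xb x] at h1
  have h3 : 0 ≤ μ / 2 * ‖x - xb‖ ^ 2 := by positivity
  have h4 : ‖x - xb‖ ^ 2 ≤ r ^ 2 := pow_le_pow_left₀ (norm_nonneg _) hr 2
  have h5 : β / 2 * ‖x - xb‖ ^ 2 ≤ β / 2 * r ^ 2 := mul_le_mul_of_nonneg_left h4 (by positivity)
  have hr0 : 0 ≤ r := (norm_nonneg _).trans hr
  refine ⟨?_, fun u hu => ?_⟩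
  · have h6 : β / 2 * ‖p x - xb‖ ^ 2 ≤ β / 2 * r ^ 2 := by linarith
    exact le_of_sq_le_sq (le_of_mul_le_mul_left h6 (by positivity)) hr0
  · have h7 := hxb.le hν hu
    have h8 : 0 ≤ β / 2 * ‖p x - xb‖ ^ 2 := by positivity
    linarith

theorem isEpsSaddle_of_forall {X : Set E} {Y : Set F} {f : E → F → ℝ} {ε : ℝ} (hX : IsCompact X)
    (hY : IsCompact Y) {x : E} {y : F} (hx : x ∈ X) (hy : y ∈ Y)
    (hfx : ContinuousOn (fun v => f x v) Y) (hfy : ContinuousOn (fun u => f u y) X)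
    (h : ∀ u ∈ X, ∀ v ∈ Y, f x v - f u y ≤ ε) : IsEpsSaddle X Y f ε x y := by
  obtain ⟨v, hv, hvm⟩ := hY.exists_isMaxOn ⟨y, hy⟩ hfx
  obtain ⟨u, hu, hum⟩ := hX.exists_isMinOn ⟨x, hx⟩ hfy
  exact ⟨hx, hy, _, _, ⟨⟨v, hv, rfl⟩, by rintro _ ⟨w, hw, rfl⟩; exact hvm hw⟩,
    ⟨⟨u, hu, rfl⟩, by rintro _ ⟨w, hw, rfl⟩; exact hum hw⟩, h u hu v hv⟩

theorem regularized_eq_pert (f : E → F → ℝ) (ε D : ℝ) (y₀ : F) (x : E) (y : F) :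
    regularized f ε D y₀ x y = pert f 0 0 (ε / D ^ 2) ((ε / D ^ 2) • y₀) x y -
      ε / D ^ 2 / 2 * ‖y₀‖ ^ 2 := by
  simp only [regularized, pert, inner_zero_left, real_inner_smul_left, norm_sub_sq_real,
    real_inner_comm y₀]
  ring

end Gap

/-! ### The gap bound, the gradient count and the final method. -/

noncomputable section Main

variable {mx Lx Lxy Ly Dx Dy R D : ℝ}

/-- The duality gap after a projected gradient step from a point near the saddle point. -/
theorem Inst.gap_le (h : Admissible mx Lx Lxy Ly Dx Dy R D) (I : Inst mx Lx Lxy Ly Dx Dy) {b L η : ℝ}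
    (hb : 0 < b) (hLx : Lx ≤ L) (hLxy : Lxy ≤ L) (hLy : Ly ≤ L) (hbL : b ≤ L)
    (hRm : Lxy / mx ≤ R) (hRb : Lxy / b ≤ R) {p : I.E} {q : I.F} {xs : I.E} {ys : I.F}
    (hs : IsStrongSaddle I.X I.Y (pert I.f 0 p b q) (mx + 0) b xs ys) {x : I.E} {y : I.F}
    (hx : x ∈ I.X) (hy : y ∈ I.Y) (hxs : ‖x - xs‖ ≤ η) (hys : ‖y - ys‖ ≤ η) {px : I.E → I.E}
    {py : I.F → I.F} (hpx : ProxStep I.X (fun u => pert I.f 0 p b q u y) px (Lx + 0) ((mx + 0) / 2))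
    (hpy : ProxStep I.Y (fun v => -pert I.f 0 p b q x v) py (Ly + b) (b / 2)) {u : I.E} {v : I.F}
    (hu : u ∈ I.X) (hv : v ∈ I.Y) :
    pert I.f 0 p b q (px x) v - pert I.f 0 p b q u (py y) ≤
      2 * L * (2 * R * η) ^ 2 + 4 * L * D * (2 * R * η) := by
  have hm : 0 < mx + 0 := by linarith [h.mx_pos]
  have hR3 := h.three_le
  have hη : 0 ≤ η := (norm_nonneg _).trans hxs
  have hmx := h.mx_pos
  have hmL := h.mx_le
  have hL0 : 0 < L := by linarith
  obtain ⟨xb, hxb⟩ := I.scc.exists_best_left 0 p b q I.compactX ⟨_, I.memX⟩ hy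
  obtain ⟨yb, hyb⟩ := I.scc.exists_best_right 0 p b q I.compactY ⟨_, I.memY⟩ hx
  set r := 2 * R * η with hr
  have hr0 : 0 ≤ r := by positivity
  have hRη : η ≤ R * η := by nlinarith
  have k1 := I.scc.best_left_lipschitz 0 p b q I.convexX hm h.Lxy_nonneg hs.2.1 hy hs.1 hxb
  have k2 := I.scc.best_right_lipschitz 0 p b q I.convexX hb h.Lxy_nonneg hs.1.1 hx hs.2 hyb
  rw [add_zero, norm_sub_rev ys y] at k1
  rw [norm_sub_rev xs x] at k2
  have k1' : ‖xs - xb‖ ≤ R * η := k1.trans (mul_le_mul hRm hys (norm_nonneg _) (by linarith))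
  have k2' : ‖ys - yb‖ ≤ R * η := k2.trans (mul_le_mul hRb hxs (norm_nonneg _) (by linarith))
  have r1 : ‖x - xb‖ ≤ r := by
    have := norm_sub_le_norm_sub_add_norm_sub x xs xb
    linarith
  have r2 : ‖y - yb‖ ≤ r := by
    have := norm_sub_le_norm_sub_add_norm_sub y ys yb
    linarith
  have hLx0 : 0 < Lx + 0 := by linarith
  have hLy0 : 0 < Ly + b := by linarith [h.Ly_nonneg]
  obtain ⟨g1, g2⟩ := hpx.le_of_isStrongMin hLx0 (by linarith) hm.le hxb r1
  obtain ⟨g3, g4⟩ := hpy.le_of_isStrongMin hLy0 (by linarith) hb.le hyb r2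
  have hxX := (hpx x).1
  have hyY := (hpy y).1
  have g2u := g2 u hu
  have g4v := g4 v hv
  -- The step in `x` was made against `y` and the step in `y` against `x`. Two mixed differences
  -- replace these opponents by the new points and need only `Lxy`, not the size of the gradients.
  have c1 := I.scc.smooth.cross_le 0 p b q I.convexX hu hxX hyY hy
  have c2 := I.scc.smooth.cross_le 0 p b q I.convexX hx hxX hv hyY
  have d1 : ‖py y - y‖ ≤ 2 * r := by
    have := norm_sub_le_norm_sub_add_norm_sub (py y) yb y
    rw [norm_sub_rev yb y] at this
    linarith
  have d2 : ‖px x - x‖ ≤ 2 * r := by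
    have := norm_sub_le_norm_sub_add_norm_sub (px x) xb x
    rw [norm_sub_rev xb x] at this
    linarith
  have d3 := I.dist_left_le h hxX hu
  have d4 := I.dist_right_le h hv hyY
  have c1' : Lxy * ‖py y - y‖ * ‖px x - u‖ ≤ L * (2 * r) * D :=
    mul_le_mul (mul_le_mul hLxy d1 (norm_nonneg _) hL0.le) d3 (norm_nonneg _) (by positivity)
  have c2' : Lxy * ‖v - py y‖ * ‖px x - x‖ ≤ L * D * (2 * r) :=
    mul_le_mul (mul_le_mul hLxy d4 (norm_nonneg _) hL0.le) d2 (norm_nonneg _)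
      (mul_nonneg hL0.le h.D_nonneg)
  have e1 : (Lx + 0) / 2 * r ^ 2 ≤ L * r ^ 2 :=
    mul_le_mul_of_nonneg_right (by linarith) (sq_nonneg _)
  have e2 : (Ly + b) / 2 * r ^ 2 ≤ L * r ^ 2 :=
    mul_le_mul_of_nonneg_right (by linarith) (sq_nonneg _)
  linarith

theorem one_le_log {R : ℝ} (hR : 3 ≤ R) : 1 ≤ Real.log R := by
  rw [Real.le_log_iff_exp_le (by linarith)]
  linarith [Real.exp_one_lt_d9]

theorem iters_le {R κ : ℝ} (hR : 3 ≤ R) (hκ : 1 ≤ κ) :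
    (iters R κ : ℝ) + 1 ≤ 402 * (√κ * Real.log R) := by
  have hl := one_le_log hR
  have hs : 1 ≤ √κ := Real.one_le_sqrt.2 hκ
  have h1 : (iters R κ : ℝ) < 400 * √κ * Real.log R + 1 := Nat.ceil_lt_add_one (by positivity)
  have h2 : 1 ≤ √κ * Real.log R := one_le_mul_of_one_le_of_one_le hs hl
  linarith

/-- Iteration counts multiply along the nesting, so only the two products in `h1` and `h2` matter;
the isolated best responses are of lower order. Each of the four loops contributes one factor `402 *
Real.log R`. -/
theorem costOuter_le {b σ τ Q : ℝ} (hR : 3 ≤ R) (hmx : 0 < mx)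
    (hb : 0 < b) (hσ : mx ≤ σ) (hτ : b ≤ τ) (hLx : mx ≤ Lx) (hLy : 0 ≤ Ly) (hQ : 1 ≤ Q)
    (h1 : σ / (mx / 2) * (τ / (b / 2)) * ((Lx + σ) / ((mx + σ) / 2)) ≤ 100 * Q)
    (h2 : σ / (mx / 2) * (τ / (b / 2)) * ((Ly + (b + τ)) / ((b + τ) / 2)) ≤ 100 * Q)
    (h3 : (Ly + b) / (b / 2) ≤ 100 * Q) :
    (costOuter mx Lx Ly R b σ τ : ℝ) + 2 ≤ 50 * 402 ^ 4 * √Q * Real.log R ^ 4 := by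
  set ℓ := Real.log R with hℓ
  have hl : 1 ≤ ℓ := one_le_log hR
  set κσ := σ / (mx / 2) with hκσ
  set κτ := τ / (b / 2) with hκτ
  set κx := (Lx + σ) / ((mx + σ) / 2) with hκx
  set κy := (Ly + (b + τ)) / ((b + τ) / 2) with hκy
  set κb := (Ly + b) / (b / 2) with hκb
  have oσ : 1 ≤ κσ := by rw [hκσ, le_div_iff₀ (by linarith)]; linarith
  have oτ : 1 ≤ κτ := by rw [hκτ, le_div_iff₀ (by linarith)]; linarith
  have ox : 1 ≤ κx := by rw [hκx, le_div_iff₀ (by linarith)]; linarith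
  have oy : 1 ≤ κy := by rw [hκy, le_div_iff₀ (by linarith)]; linarith
  have ob : 1 ≤ κb := by rw [hκb, le_div_iff₀ (by linarith)]; linarith
  have iσ := iters_le hR oσ
  have iτ := iters_le hR oτ
  have ix := iters_le hR ox
  have iy := iters_le hR oy
  have ib := iters_le hR ob
  have i1 : (iters R 1 : ℝ) ≤ 402 * ℓ := by
    have := iters_le hR (le_refl 1)
    rw [Real.sqrt_one, one_mul] at this
    linarith
  have q0 : 0 ≤ √Q := Real.sqrt_nonneg _
  have q1 : 1 ≤ √Q := Real.one_le_sqrt.2 hQ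
  have s10 : √(100 * Q) = 10 * √Q := by
    rw [Real.sqrt_mul (by norm_num), show (100 : ℝ) = 10 ^ 2 by norm_num,
      Real.sqrt_sq (by norm_num)]
  have sx : √κσ * √κτ * √κx ≤ 10 * √Q := by
    rw [← Real.sqrt_mul (by linarith), ← Real.sqrt_mul (mul_nonneg (by linarith) (by linarith)),
      ← s10]
    exact Real.sqrt_le_sqrt h1
  have sy : √κσ * √κτ * √κy ≤ 10 * √Q := by
    rw [← Real.sqrt_mul (by linarith), ← Real.sqrt_mul (mul_nonneg (by linarith) (by linarith)),
      ← s10]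
    exact Real.sqrt_le_sqrt h2
  have sb : √κb ≤ 10 * √Q := by rw [← s10]; exact Real.sqrt_le_sqrt h3
  have tτ : 1 ≤ √κτ := Real.one_le_sqrt.2 oτ
  have inner : (costInner mx Lx Ly R σ b τ : ℝ) ≤ 2 * 402 ^ 3 * (√κτ * (√κx + √κy)) * ℓ ^ 3 := by
    have e : (costInner mx Lx Ly R σ b τ : ℝ) = ((iters R κτ : ℝ) + 1) * ((iters R 1 : ℝ) *
      (((iters R κx : ℝ) + 1) + ((iters R κy : ℝ) + 1))) + ((iters R κx : ℝ) + 1) := by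
      simp only [costInner]; push_cast; rfl
    have p1 : (iters R 1 : ℝ) * (((iters R κx : ℝ) + 1) + ((iters R κy : ℝ) + 1)) ≤
        402 * ℓ * (402 * (√κx * ℓ) + 402 * (√κy * ℓ)) := by gcongr
    have p2 : ((iters R κτ : ℝ) + 1) * ((iters R 1 : ℝ) *
      (((iters R κx : ℝ) + 1) + ((iters R κy : ℝ) + 1))) ≤
        402 * (√κτ * ℓ) * (402 * ℓ * (402 * (√κx * ℓ) + 402 * (√κy * ℓ))) := by gcongr
    have p3 : 402 * (√κx * ℓ) ≤ 402 ^ 3 * (√κτ * (√κx + √κy)) * ℓ ^ 3 := by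
      have a1 : √κx ≤ √κτ * (√κx + √κy) := by
        calc √κx ≤ 1 * (√κx + √κy) := by linarith [Real.sqrt_nonneg κy]
          _ ≤ _ := by gcongr
      have a2 : ℓ ≤ ℓ ^ 3 := le_self_pow₀ hl (by norm_num)
      calc 402 * (√κx * ℓ) ≤ 402 ^ 3 * ((√κτ * (√κx + √κy)) * ℓ ^ 3) := by gcongr; norm_num
        _ = _ := by ring
    rewrite [e]
    calc _ ≤ 402 * (√κτ * ℓ) * (402 * ℓ * (402 * (√κx * ℓ) + 402 * (√κy * ℓ))) +
          402 ^ 3 * (√κτ * (√κx + √κy)) * ℓ ^ 3 := add_le_add p2 (ix.trans p3)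
      _ = _ := by ring
  have e : (costOuter mx Lx Ly R b σ τ : ℝ) = ((iters R κσ : ℝ) + 1) *
      (costInner mx Lx Ly R σ b τ : ℝ) + ((iters R κb : ℝ) + 1) := by
    simp only [costOuter]; push_cast; rfl
  have l4 : 1 ≤ ℓ ^ 4 := one_le_pow₀ hl
  have l4' : ℓ ≤ ℓ ^ 4 := le_self_pow₀ hl (by norm_num)
  have p1 : ((iters R κσ : ℝ) + 1) * (costInner mx Lx Ly R σ b τ : ℝ) ≤
      40 * 402 ^ 4 * (√Q * ℓ ^ 4) := by
    calc _ ≤ 402 * (√κσ * ℓ) * (2 * 402 ^ 3 * (√κτ * (√κx + √κy)) * ℓ ^ 3) := by gcongr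
      _ = 2 * 402 ^ 4 * (√κσ * √κτ * √κx + √κσ * √κτ * √κy) * ℓ ^ 4 := by ring
      _ ≤ 2 * 402 ^ 4 * (10 * √Q + 10 * √Q) * ℓ ^ 4 := by gcongr
      _ = _ := by ring
  have p2 : (iters R κb : ℝ) + 1 ≤ 4020 * (√Q * ℓ ^ 4) := by
    calc _ ≤ 402 * (√κb * ℓ) := ib
      _ ≤ 402 * (10 * √Q * ℓ ^ 4) := by gcongr
      _ = _ := by ring
  have p3 : 1 ≤ √Q * ℓ ^ 4 := one_le_mul_of_one_le_of_one_le q1 l4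
  rewrite [e, mul_assoc (50 * 402 ^ 4)]
  linarith

/-- The modulus `2 * mx + 2 * Lxy` of the best-response problem cancels against `σ = 2 * Lxy + mx`.
What remains is of order `(Lxy + b) * (Lx + Lxy) / (mx * b)`, and `b` and `Lxy` are at most `L`. In
`complexity_right` the cancellation is against `τ`. -/
theorem complexity_left {b L : ℝ} (hmx : 0 < mx) (hb : 0 < b) (hLx : mx ≤ Lx) (hLxy : 0 ≤ Lxy)
    (hLy : 0 ≤ Ly) (hbL : b ≤ L) (hLxL : Lx ≤ L) (hLxyL : Lxy ≤ L) :
    (2 * Lxy + mx) / (mx / 2) * ((2 * Lxy + b) / (b / 2)) *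
      ((Lx + (2 * Lxy + mx)) / ((mx + (2 * Lxy + mx)) / 2)) ≤
      100 * (Lx / mx + (L * Lxy / mx + Ly) * (1 / b)) := by
  have hLxp : 0 < Lx := hmx.trans_le hLx
  have hL0 : 0 < L := hLxp.trans_le hLxL
  have e1 : (2 * Lxy + mx) / (mx / 2) * ((2 * Lxy + b) / (b / 2)) *
      ((Lx + (2 * Lxy + mx)) / ((mx + (2 * Lxy + mx)) / 2)) =
      (2 * Lxy + mx) / (2 * mx + 2 * Lxy) *
        (8 * (2 * Lxy + b) * (Lx + 2 * Lxy + mx) / (mx * b)) := by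
    field_simp; ring
  have e2 : 100 * (Lx / mx + (L * Lxy / mx + Ly) * (1 / b)) =
      100 * (Lx * b + L * Lxy + mx * Ly) / (mx * b) := by
    field_simp
    ring
  have f1 : (2 * Lxy + mx) / (2 * mx + 2 * Lxy) ≤ 1 := by
    rw [div_le_one (by positivity)]; linarith
  rewrite [e1, e2]
  calc _ ≤ 1 * (8 * (2 * Lxy + b) * (Lx + 2 * Lxy + mx) / (mx * b)) := by gcongr
    _ ≤ _ := by
      rw [one_mul]
      apply div_le_div_of_nonneg_right _ (by positivity)
      have g1 : Lxy * Lx ≤ L * Lxy := by nlinarith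
      have g2 : Lxy * Lxy ≤ L * Lxy := by nlinarith
      have g3 : Lxy * b ≤ L * Lxy := by nlinarith
      have g4 : Lxy * mx ≤ L * Lxy := by nlinarith
      have g5 : b * mx ≤ Lx * b := by nlinarith
      have g6 : 0 ≤ mx * Ly := by positivity
      have g7 : 0 ≤ Lx * b := by positivity
      have g8 : 0 ≤ L * Lxy := by positivity
      linarith

theorem complexity_right {b L : ℝ} (hmx : 0 < mx) (hb : 0 < b) (hLx : mx ≤ Lx) (hLxy : 0 ≤ Lxy)
    (hLy : 0 ≤ Ly) (hbL : b ≤ L) (hLxL : Lx ≤ L) (hLxyL : Lxy ≤ L) (hLyL : Ly ≤ L) :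
    (2 * Lxy + mx) / (mx / 2) * ((2 * Lxy + b) / (b / 2)) *
      ((Ly + (b + (2 * Lxy + b))) / ((b + (2 * Lxy + b)) / 2)) ≤
      100 * (Lx / mx + (L * Lxy / mx + Ly) * (1 / b)) := by
  have hLxp : 0 < Lx := hmx.trans_le hLx
  have hL0 : 0 < L := hLxp.trans_le hLxL
  have e1 : (2 * Lxy + mx) / (mx / 2) * ((2 * Lxy + b) / (b / 2)) *
      ((Ly + (b + (2 * Lxy + b))) / ((b + (2 * Lxy + b)) / 2)) =
      (2 * Lxy + b) / (2 * b + 2 * Lxy) *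
        (8 * (2 * Lxy + mx) * (Ly + 2 * Lxy + 2 * b) / (mx * b)) := by
    field_simp; ring
  have e2 : 100 * (Lx / mx + (L * Lxy / mx + Ly) * (1 / b)) =
      100 * (Lx * b + L * Lxy + mx * Ly) / (mx * b) := by
    field_simp
    ring
  have f1 : (2 * Lxy + b) / (2 * b + 2 * Lxy) ≤ 1 := by
    rw [div_le_one (by positivity)]; linarith
  rewrite [e1, e2]
  calc _ ≤ 1 * (8 * (2 * Lxy + mx) * (Ly + 2 * Lxy + 2 * b) / (mx * b)) := by gcongr
    _ ≤ _ := by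
      rw [one_mul]
      apply div_le_div_of_nonneg_right _ (by positivity)
      have g1 : Lxy * Ly ≤ L * Lxy := by nlinarith
      have g2 : Lxy * Lxy ≤ L * Lxy := by nlinarith
      have g3 : Lxy * b ≤ L * Lxy := by nlinarith
      have g4 : Lxy * mx ≤ L * Lxy := by nlinarith
      have g5 : b * mx ≤ Lx * b := by nlinarith
      have g6 : 0 ≤ mx * Ly := by positivity
      have g7 : 0 ≤ Lx * b := by positivity
      have g8 : 0 ≤ L * Lxy := by positivity
      linarith

theorem exists_method {ε L : ℝ} (hmx : 0 < mx) (hLx : mx ≤ Lx) (hLxy : 0 ≤ Lxy) (hLy : 0 ≤ Ly)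
    (hDx : 0 ≤ Dx) (hDy : 0 < Dy) (hε : 0 < ε) (hLxL : Lx ≤ L) (hLxyL : Lxy ≤ L) (hLyL : Ly ≤ L)
    (hεL : ε ≤ L * Dy ^ 2) :
    ∃ P : Method, (Method.gradCount P : ℝ) ≤
      50 * 402 ^ 4 * √(Lx / mx + (L * Lxy / mx + Ly) * (Dy ^ 2 / ε)) *
        Real.log (2 + (Dx + Dy) ^ 2 * L ^ 2 / (mx * ε)) ^ 4 ∧
      ∀ I : Inst mx Lx Lxy Ly Dx Dy,
        IsEpsSaddle I.X I.Y (regularized I.f ε Dy I.y₀) (ε / 2)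
          (Method.outX I.X I.Y I.f P I.x₀ I.y₀) (Method.outY I.X I.Y I.f P I.x₀ I.y₀) ∧
        IsEpsSaddle I.X I.Y I.f ε
          (Method.outX I.X I.Y I.f P I.x₀ I.y₀) (Method.outY I.X I.Y I.f P I.x₀ I.y₀) := by
  set R := 2 + (Dx + Dy) ^ 2 * L ^ 2 / (mx * ε) with hR
  set D := Dx + Dy with hD
  set b := ε / Dy ^ 2 with hbd
  have hD0 : 0 < D := by positivity
  have hL0 : 0 < L := by linarith
  have hb : 0 < b := by positivity
  have hbL : b ≤ L := by rw [hbd, div_le_iff₀ (by positivity)]; exact hεL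
  have hmL : mx ≤ L := hLx.trans hLxL
  have hRΛ : L ^ 2 / (mx * b) ≤ R - 2 := by
    have e : L ^ 2 / (mx * b) = Dy ^ 2 * L ^ 2 / (mx * ε) := by rw [hbd]; field_simp
    have : R - 2 = D ^ 2 * L ^ 2 / (mx * ε) := by rw [hR]; ring
    rw [e, this]
    gcongr
    linarith
  have hmb : 0 < mx * b := by positivity
  -- From this and `mx, b ≤ L` it follows that `R` dominates both `L / mx` and `L / b`, hence every
  -- condition number is below `9 * R ≤ R ^ 3`.
  have hL2 : L * L ≤ (R - 2) * (mx * b) := by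
    rw [div_le_iff₀ hmb] at hRΛ; linarith
  have hR3 : 3 ≤ R := by
    have : mx * b ≤ L * L := mul_le_mul hmL hbL hb.le hL0.le
    have : 1 ≤ R - 2 := by
      by_contra! hlt
      have : (R - 2) * (mx * b) < 1 * (mx * b) := mul_lt_mul_of_pos_right hlt hmb
      linarith
    linarith
  have hLm : L ≤ R * mx := by
    have h1 : (R - 2) * (mx * b) ≤ R * mx * L := by
      have : mx * b ≤ mx * L := mul_le_mul_of_nonneg_left hbL hmx.le
      have := mul_le_mul_of_nonneg_left this (show 0 ≤ R - 2 by linarith)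
      have : 0 ≤ mx * L := by positivity
      linarith
    exact le_of_mul_le_mul_right (hL2.trans h1) hL0
  have hLb : L ≤ R * b := by
    have h1 : (R - 2) * (mx * b) ≤ R * b * L := by
      have : mx * b ≤ L * b := mul_le_mul_of_nonneg_right hmL hb.le
      have := mul_le_mul_of_nonneg_left this (show 0 ≤ R - 2 by linarith)
      have : 0 ≤ L * b := by positivity
      linarith
    exact le_of_mul_le_mul_right (hL2.trans h1) hL0
  have hLD : L * D ^ 2 ≤ R * ε := by
    have h1 : D ^ 2 * L ^ 2 / (mx * ε) ≤ R := by rw [hR]; linarith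
    rw [div_le_iff₀ (by positivity)] at h1
    have h2 : R * (mx * ε) ≤ R * (L * ε) := by gcongr
    have h3 : L * D ^ 2 * L ≤ R * ε * L := by linarith
    exact le_of_mul_le_mul_right h3 hL0
  have hR9 : 9 * R ≤ R ^ 3 := by
    have : (3 : ℝ) ^ 2 ≤ R ^ 2 := pow_le_pow_left₀ (by norm_num) hR3 2
    have := mul_le_mul_of_nonneg_right this (show 0 ≤ R by linarith)
    linarith
  have hcond : ∀ A m : ℝ, 0 < m → A ≤ 9 * R * (m / 2) → A / (m / 2) ≤ R ^ 3 := fun A m hm hA => by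
    rw [div_le_iff₀ (by positivity)]
    exact hA.trans (mul_le_mul_of_nonneg_right hR9 (by positivity))
  have hRmx : 3 * mx ≤ R * mx := mul_le_mul_of_nonneg_right hR3 hmx.le
  have hRb : 3 * b ≤ R * b := mul_le_mul_of_nonneg_right hR3 hb.le
  have hRxy : 3 * Lxy ≤ R * Lxy := mul_le_mul_of_nonneg_right hR3 hLxy
  have hadm : Admissible mx Lx Lxy Ly Dx Dy R D :=
    ⟨hmx, hLx, hLxy, hLy, hR3, by linarith, by linarith, hD0.le⟩
  have hRmx' : Lxy / mx ≤ R := by rw [div_le_iff₀ hmx]; linarith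
  have hRb' : Lxy / b ≤ R := by rw [div_le_iff₀ hb]; linarith
  choose xs ys hs using fun I : Inst mx Lx Lxy Ly Dx Dy =>
    I.scc.exists_isStrongSaddle 0 (0 : I.E) b (b • I.y₀) I.compactX I.convexX ⟨_, I.memX⟩
      I.compactY I.convexY ⟨_, I.memY⟩ (by linarith) hb.le
  have init : HasInit (initial : Known mx Lx Lxy Ly Dx Dy) := ⟨rfl, rfl⟩
  -- The solvers need the linear terms `0` and `b • y₀` of the regularized problem as computed
  -- vectors.
  obtain ⟨S1, d1, m1⟩ : ∃ S, Der 0 initial S ∧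
      (fun I : Inst mx Lx Lxy Ly Dx Dy => (0 : ℝ) • I.x₀ + (0 : ℝ) • I.x₀) ∈ S.1 :=
    ⟨_, Der.combX init.1 init.1 0 0, Set.mem_insert _ _⟩
  obtain ⟨S2, d2, m2⟩ : ∃ S, Der 0 S1 S ∧
      (fun I : Inst mx Lx Lxy Ly Dx Dy => b • I.y₀ + (0 : ℝ) • I.y₀) ∈ S.2 :=
    ⟨_, Der.combY (init.mono d1).2 (init.mono d1).2 b 0, Set.mem_insert _ _⟩
  simp only [zero_smul, add_zero] at m1 m2
  have m1' := d2.1 m1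
  obtain ⟨S3, d3, x, hx, y, hy, hxy⟩ := solve_prox_left hadm (b := b) (σ := 2 * Lxy + mx)
    (τ := 2 * Lxy + b) (by linarith) hb (by linarith) (by linarith) (by linarith) hRb'
    (hcond _ _ (by linarith) (by linarith)) (hcond _ _ (by linarith) (by linarith))
    (hcond _ _ (by linarith) (by linarith)) (hcond _ _ (by linarith) (by linarith))
    (hcond _ _ (by linarith) (by linarith)) ((init.mono d1).mono d2) m1' m2 hs
    (j := 6) (by norm_num)
  -- The last projected gradient steps, both taken from the same pair; they account for the `+ 2` in
  -- the count.
  obtain ⟨S4, d4, hx'⟩ := Der.projGrad_left 0 (Lx + 0) (d3.1 m1') hx hy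
  obtain ⟨S5, d5, hy'⟩ := Der.projGrad_right b (Ly + b) (d4.2.1 (d3.2.1 m2)) (d4.2.1 hy) (d4.1 hx)
  obtain ⟨P, hP, hout⟩ := ((((d1.trans d2).trans d3).trans d4).trans d5).exists_method
    (d5.1 hx') hy'
  refine ⟨P, ?_, fun I => ?_⟩
  · have eb : Dy ^ 2 / ε = 1 / b := by rw [hbd]; field_simp
    rewrite [eb]
    have hQ : 1 ≤ Lx / mx + (L * Lxy / mx + Ly) * (1 / b) := by
      have h1 : 1 ≤ Lx / mx := (one_le_div hmx).2 hLx
      have h2 : 0 ≤ (L * Lxy / mx + Ly) * (1 / b) := by positivity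
      linarith
    have hcost := costOuter_le (R := R) (b := b) (σ := 2 * Lxy + mx) (τ := 2 * Lxy + b) hR3 hmx hb
      (by linarith) (by linarith) hLx hLy hQ
      (complexity_left hmx hb hLx hLxy hLy hbL hLxL hLxyL)
      (complexity_right hmx hb hLx hLxy hLy hbL hLxL hLxyL hLyL)
      (by
        have e : (Ly + b) / (b / 2) = 2 * (Ly * (1 / b)) + 2 := by field_simp
        have h1 : 1 ≤ Lx / mx := (one_le_div hmx).2 hLx
        have h2 : 0 ≤ L * Lxy / mx * (1 / b) := by positivity
        have h3 : 0 ≤ Ly * (1 / b) := by positivity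
        rw [e]
        linarith)
    have hP' : (Method.gradCount P : ℝ) ≤
        (costOuter mx Lx Ly R b (2 * Lxy + mx) (2 * Lxy + b) : ℝ) + 2 := by
      have : Method.gradCount P ≤ costOuter mx Lx Ly R b (2 * Lxy + mx) (2 * Lxy + b) + 2 := by
        omega
      exact_mod_cast this
    exact hP'.trans hcost
  · obtain ⟨ox, oy⟩ := hout I
    rewrite [ox, oy]
    obtain ⟨hxX, hyY, hxη, hyη⟩ := hxy I
    have stepx := I.proxStep_left hadm le_rfl (0 : I.E) b (b • I.y₀) hyY
    have stepy := I.proxStep_right hadm 0 (0 : I.E) hb (b • I.y₀) hxX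
    set x' := proj I.X (x I - (Lx + 0)⁻¹ •
      (gradX I.f (proj I.X (x I)) (y I) + ((0 : ℝ) • proj I.X (x I) - 0))) with hx'd
    set y' := proj I.Y (y I - (Ly + b)⁻¹ •
      (-gradY I.f (x I) (proj I.Y (y I)) + (b • proj I.Y (y I) - b • I.y₀))) with hy'd
    have hx'X : x' ∈ I.X := (stepx (x I)).1
    have hy'Y : y' ∈ I.Y := (stepy (y I)).1
    have hgap : ∀ u ∈ I.X, ∀ v ∈ I.Y, regularized I.f ε Dy I.y₀ x' v -
        regularized I.f ε Dy I.y₀ u y' ≤ ε / 2 := fun u hu v hv => by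
      have hg := I.gap_le hadm hb hLxL hLxyL hLyL hbL hRmx' hRb' (hs I) hxX hyY hxη hyη
        stepx stepy hu hv
      rewrite [regularized_eq_pert, regularized_eq_pert]
      -- Accuracy `j = 6` suffices: with `L * D ^ 2 ≤ R * ε` and `R ≥ 3` the gap is at most `16 / 81
      -- * ε`.
      have e1 : 2 * L * (2 * R * (D / R ^ 6)) ^ 2 + 4 * L * D * (2 * R * (D / R ^ 6)) =
          L * D ^ 2 * (8 / R ^ 10 + 8 / R ^ 5) := by field_simp; ring
      have hR0 : 0 < R := by linarith
      have e2 : L * D ^ 2 * (8 / R ^ 10 + 8 / R ^ 5) ≤ R * ε * (8 / R ^ 10 + 8 / R ^ 5) :=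
        mul_le_mul_of_nonneg_right hLD (by positivity)
      have e3 : R * ε * (8 / R ^ 10 + 8 / R ^ 5) = ε * (8 * (1 / R ^ 9) + 8 * (1 / R ^ 4)) := by
        field_simp
      have f1 : 1 / R ^ 9 ≤ 1 / 81 := by
        apply one_div_le_one_div_of_le (by norm_num)
        calc (81 : ℝ) ≤ 3 ^ 9 := by norm_num
          _ ≤ R ^ 9 := pow_le_pow_left₀ (by norm_num) hR3 9
      have f2 : 1 / R ^ 4 ≤ 1 / 81 := by
        apply one_div_le_one_div_of_le (by norm_num)
        calc (81 : ℝ) ≤ 3 ^ 4 := by norm_num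
          _ ≤ R ^ 4 := pow_le_pow_left₀ (by norm_num) hR3 4
      have f3 : ε * (8 * (1 / R ^ 9) + 8 * (1 / R ^ 4)) ≤ ε * (1 / 2) :=
        mul_le_mul_of_nonneg_left (by linarith) hε.le
      linarith
    have cx : ∀ y ∈ I.Y, ContinuousOn (fun u => I.f u y) I.X := fun y hy u hu =>
      (I.scc.smooth.hasGradientAt_left hu hy).differentiableAt.continuousAt.continuousWithinAt
    have cy : ∀ x ∈ I.X, ContinuousOn (fun v => I.f x v) I.Y := fun x hx v hv =>
      (I.scc.smooth.hasGradientAt_right hx hv).differentiableAt.continuousAt.continuousWithinAt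
    refine ⟨isEpsSaddle_of_forall I.compactX I.compactY hx'X hy'Y ?_ ?_ hgap,
      isEpsSaddle_of_forall I.compactX I.compactY hx'X hy'Y (cy _ hx'X) (cx _ hy'Y)
        fun u hu v hv => ?_⟩
    · exact (cy _ hx'X).sub (by fun_prop)
    · exact (cx _ hy'Y).sub continuousOn_const
    · have hg := hgap u hu v hv
      simp only [regularized] at hg
      have hv0 : ‖v - I.y₀‖ ≤ Dy := by
        rw [← dist_eq_norm]
        exact (Metric.dist_le_diam_of_mem I.compactY.isBounded hv I.memY).trans I.diamY
      have h1 : ε * ‖v - I.y₀‖ ^ 2 / (2 * Dy ^ 2) ≤ ε / 2 := by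
        have h2 : ‖v - I.y₀‖ ^ 2 ≤ Dy ^ 2 := pow_le_pow_left₀ (norm_nonneg _) hv0 2
        rw [div_le_div_iff₀ (by positivity) (by norm_num)]
        have := mul_le_mul_of_nonneg_left h2 hε.le
        linarith
      have h3 : 0 ≤ ε * ‖y' - I.y₀‖ ^ 2 / (2 * Dy ^ 2) := by positivity
      linarith

end Main

end Minimax

theorem corollary1 :
    ∃ C : ℝ, 0 < C ∧
      ∀ mx Lx Lxy Ly Dx Dy ε : ℝ,
        0 < mx → mx ≤ Lx → 0 ≤ Lxy → 0 ≤ Ly → 0 ≤ Dx → 0 < Dy →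
        0 < ε → ε ≤ max Lxy mx * Dy ^ 2 →
        ∃ P : Minimax.Method,
          ((Minimax.Method.gradCount P : ℝ) ≤
            C * Real.sqrt (Lx / mx + (Minimax.maxL Lx Lxy Ly * Lxy / mx + Ly) * (Dy ^ 2 / ε)) *
              Minimax.logFactor mx (Minimax.maxL Lx Lxy Ly) Dx Dy ε) ∧
          (ε * Lx ≤ (mx * Ly + Minimax.maxL Lx Lxy Ly * Lxy) * Dy ^ 2 →
            (Minimax.Method.gradCount P : ℝ) ≤
              C * Dy * Real.sqrt ((mx * Ly + Minimax.maxL Lx Lxy Ly * Lxy) / (mx * ε)) *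
                Minimax.logFactor mx (Minimax.maxL Lx Lxy Ly) Dx Dy ε) ∧
          ∀ (n m : ℕ) (X : Set (EuclideanSpace ℝ (Fin n))) (Y : Set (EuclideanSpace ℝ (Fin m)))
            (f : EuclideanSpace ℝ (Fin n) → EuclideanSpace ℝ (Fin m) → ℝ)
            (x₀ : EuclideanSpace ℝ (Fin n)) (y₀ : EuclideanSpace ℝ (Fin m)),
            IsCompact X → Convex ℝ X → IsCompact Y → Convex ℝ Y → x₀ ∈ X → y₀ ∈ Y →
            Metric.diam X ≤ Dx → Metric.diam Y ≤ Dy →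
            Minimax.IsSCC X Y f mx Lx Lxy Ly →
            Minimax.IsEpsSaddle X Y (Minimax.regularized f ε Dy y₀) (ε / 2)
                (Minimax.Method.outX X Y f P x₀ y₀) (Minimax.Method.outY X Y f P x₀ y₀) ∧
              Minimax.IsEpsSaddle X Y f ε
                (Minimax.Method.outX X Y f P x₀ y₀) (Minimax.Method.outY X Y f P x₀ y₀) := by
  -- Twice the constant of `exists_method`: in the second bound `Lx / mx` is absorbed into the other
  -- term, which doubles the radicand.
  refine ⟨100 * 402 ^ 4, by norm_num, ?_⟩
  intro mx Lx Lxy Ly Dx Dy ε hmx hLx hLxy hLy hDx hDy hε hεm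
  set L := Minimax.maxL Lx Lxy Ly with hL
  have hLxL : Lx ≤ L := le_max_left _ _
  have hLxyL : Lxy ≤ L := (le_max_left _ _).trans (le_max_right _ _)
  have hLyL : Ly ≤ L := (le_max_right _ _).trans (le_max_right _ _)
  have hεL : ε ≤ L * Dy ^ 2 :=
    hεm.trans (mul_le_mul_of_nonneg_right (max_le hLxyL (hLx.trans hLxL)) (sq_nonneg _))
  obtain ⟨P, hP, hI⟩ :=
    Minimax.exists_method hmx hLx hLxy hLy hDx hDy hε hLxL hLxyL hLyL hεL
  have hL0 : 0 < L := by linarith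
  have hlog : 0 ≤ Minimax.logFactor mx L Dx Dy ε := by
    unfold Minimax.logFactor
    positivity
  change (Minimax.Method.gradCount P : ℝ) ≤ 50 * 402 ^ 4 * √_ * Minimax.logFactor mx L Dx Dy ε at hP
  refine ⟨P, hP.trans ?_, fun hε' => hP.trans ?_, ?_⟩
  · exact mul_le_mul_of_nonneg_right
      (mul_le_mul_of_nonneg_right (by norm_num) (Real.sqrt_nonneg _)) hlog
  · refine mul_le_mul_of_nonneg_right ?_ hlog
    set A := (mx * Ly + L * Lxy) / (mx * ε) with hA
    have hA0 : 0 ≤ A := by positivity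
    have h1 : Lx / mx ≤ Dy ^ 2 * A := by
      rw [hA, ← mul_div_assoc, div_le_div_iff₀ hmx (by positivity)]
      have := mul_le_mul_of_nonneg_left hε' hmx.le
      linarith
    have h2 : (L * Lxy / mx + Ly) * (Dy ^ 2 / ε) = Dy ^ 2 * A := by
      rw [hA]; field_simp; ring
    have h3 : √(Lx / mx + (L * Lxy / mx + Ly) * (Dy ^ 2 / ε)) ≤ 2 * (Dy * √A) := by
      rw [h2]
      apply Real.sqrt_le_iff.2 ⟨by positivity, ?_⟩
      rw [mul_pow, mul_pow, Real.sq_sqrt hA0]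
      have : 0 ≤ Dy ^ 2 * A := by positivity
      linarith
    have h4 := mul_le_mul_of_nonneg_left h3 (show (0 : ℝ) ≤ 50 * 402 ^ 4 by norm_num)
    linarith
  · intro n m X Y f x₀ y₀ hX hXc hY hYc hx hy hdX hdY hf
    exact hI ⟨n, m, X, Y, f, x₀, y₀, hX, hXc, hY, hYc, hx, hy, hdX, hdY, hf⟩
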